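/- Let $L$ be a finite-dimensional real Lie group and $G\subset L$ a closed connected subgroup such that the quotient $X=L/G$, with the left action of $L$, is homeomorphic to $\mathbb{R}$. (Then $L$ is connected and $G$ has codimension one.) Suppose that $L$ has a normal, nilpotent, connected Lie subgroup $N$ (not necessarily closed) that is not contained in $G$. For a subgroup $H$ of $L$ write $\mathrm{Lie}(H)=\{v\in T_1L : \exp(tv)\in H \text{ for all } t\in\mathbb{R}\}$, and put $\mathfrak{L}=T_1L$, $\mathfrak{g}=\mathrm{Lie}(G)$, $\mathfrak{n}=\mathrm{Lie}(N)$. Let $G_0$ be the largest normal subgroup of $L$ contained in $G$, and let $\mathrm{Aff}^+(\mathbb{R})$ be the group of maps $x\mapsto ax+b$ with $a>0$. Then there are a diffeomorphism $f:X\to\mathbb{R}$ and a smooth homomorphism $\rho:L\to\mathrm{Aff}^+(\mathbb{R})$ such that, with $Tr\subset L$ the preimage under $\rho$ of the group of translations, the following hold. 1. $f(l\cdot x)=\rho(l)(f(x))$ for all $l\in L$, $x\in X$; that is, $X$ is identified with $\mathbb{R}$ and the action of $L$ factors through $\rho$. 2. The subgroup $Tr$ is normal in $L$. The group $G_0$ is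 the subgroup of elements of $L$ that act trivially on $X$, and $G_0=\bigcap_{l\in L} lGl^{-1}$. Moreover $Tr=G_0\cdot N$. The Lie algebra of $G_0$ is $\mathfrak{g}_0=\{u\in\mathfrak{g} : [u,v]\in\mathfrak{g}\text{ for all }v\in\mathfrak{L}\}$, and $\mathrm{Lie}(Tr)=\mathfrak{g}_0+\mathfrak{n}$. A one-parameter group $J\subset L$ acts transitively or trivially on $X$ if and only if $J\subset Tr$. 3. If $J$ is a one-parameter group of $L$ whose $\mathrm{Ad}$-action on $\mathfrak{L}$ is parabolic (every $\mathrm{Ad}_j$, $j\in J$, is unipotent) or elliptic (every $\mathrm{Ad}_j$, $j\in J$, is semisimple with all complex eigenvalues of modulus one), then $J\subset Tr$, and $J$ acts transitively or trivially on $X$. -/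

import Mathlib

open scoped Manifold ContDiff Pointwise

/-! ### Orientation-preserving affine maps of the line -/

/-- The group `Aff⁺(ℝ)` of the maps `x ↦ a * x + b` with `a > 0`. -/
def AffPlus : Subgroup (ℝ ≃ᵃ[ℝ] ℝ) where
  carrier := {g | 0 < g.linear 1}
  one_mem' := by
    show (0 : ℝ) < (1 : ℝ ≃ᵃ[ℝ] ℝ).linear 1
    simp [AffineEquiv.one_def]
  mul_mem' := by
    intro g h hg hh
    have key : (g * h).linear 1 = h.linear 1 * g.linear 1 := by
      have : (g * h).linear 1 = g.linear (h.linear 1 • (1 : ℝ)) := by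
        simp only [smul_eq_mul, mul_one]
        rfl
      rw [this, map_smul, smul_eq_mul]
    show (0 : ℝ) < (g * h).linear 1
    rw [key]
    exact mul_pos hh hg
  inv_mem' := by
    intro g hg
    have key : g.linear 1 * (g⁻¹).linear 1 = 1 := by
      have h2 : g.linear ((g⁻¹).linear 1) = 1 := by
        simp [AffineEquiv.inv_def]
      have h3 : g.linear ((g⁻¹).linear 1 • (1 : ℝ)) = (g⁻¹).linear 1 * g.linear 1 := by
        rw [map_smul, smul_eq_mul]
      rw [smul_eq_mul, mul_one, h2] at h3
      rw [mul_comm]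
      exact h3.symm
    have hg' : (0 : ℝ) < g.linear 1 := hg
    show (0 : ℝ) < (g⁻¹).linear 1
    exact pos_of_mul_pos_right (by rw [key]; exact one_pos) hg'.le

/-- The slope `a` of the affine map `x ↦ a * x + b`. -/
def AffPlus.slope (g : AffPlus) : ℝ := (g : ℝ ≃ᵃ[ℝ] ℝ).linear 1

/-- The intercept `b` of the affine map `x ↦ a * x + b`. -/
def AffPlus.intercept (g : AffPlus) : ℝ := (g : ℝ ≃ᵃ[ℝ] ℝ) 0

/-- The translations `x ↦ x + c`, as a subgroup of `Aff⁺(ℝ)`. -/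
def AffPlus.translations : Subgroup AffPlus :=
  (AffineEquiv.constVAddHom ℝ ℝ).range.subgroupOf AffPlus

namespace LieLine

variable {n : ℕ} {L : Type*} [TopologicalSpace L] [ChartedSpace (EuclideanSpace ℝ (Fin n)) L]
  [Group L]

/-- A smooth Lie group is regular enough for its tangent space at `1` to be a Lie algebra. -/
instance [LieGroup (𝓡 n) ∞ L] : LieGroup (𝓡 n) (minSmoothness ℝ 3) L :=
  LieGroup.of_le (n := ∞) (by
    rw [minSmoothness_of_isRCLikeNormedField]
    exact ENat.LEInfty.out)

/-- One-parameter groups: continuous homomorphisms from the additive group `ℝ`. -/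
structure IsOneParameterGroup {L : Type*} [TopologicalSpace L] [Group L] (γ : ℝ → L) : Prop where
  continuous : Continuous γ
  map_add : ∀ s t, γ (s + t) = γ s * γ t

/-- `γ` is the one-parameter group `t ↦ exp (t v)`, that is, the one with `γ'(0) = v`. -/
structure IsExpOf (v : GroupLieAlgebra (𝓡 n) L) (γ : ℝ → L) : Prop where
  isOneParameterGroup : IsOneParameterGroup γ
  hasMFDerivAt : HasMFDerivAt 𝓘(ℝ, ℝ) (𝓡 n) γ 0
    (ContinuousLinearMap.toSpanSingleton ℝ (v : EuclideanSpace ℝ (Fin n)))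

variable (n) in
/-- The Lie algebra of a subgroup `H` of `L`: the vectors `v` with `exp (t v) ∈ H` for all `t`. -/
def lieAlg (H : Subgroup L) : Set (GroupLieAlgebra (𝓡 n) L) :=
  {v | ∃ γ : ℝ → L, IsExpOf v γ ∧ ∀ t, γ t ∈ H}

variable (n) in
/-- `H` is a connected (not necessarily closed) Lie subgroup of `L`: it is generated by `exp 𝔥`
for some Lie subalgebra `𝔥` of the Lie algebra of `L`. -/
def IsConnectedLieSubgroup [LieGroup (𝓡 n) ∞ L] (H : Subgroup L) : Prop :=
  ∃ 𝔥 : LieSubalgebra ℝ (GroupLieAlgebra (𝓡 n) L),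
    H = Subgroup.closure {g | ∃ v ∈ 𝔥, ∃ γ : ℝ → L, IsExpOf v γ ∧ γ 1 = g}

variable (n) in
/-- The adjoint action of `g` on the Lie algebra of `L`: the derivative at `1` of `x ↦ g x g⁻¹`. -/
noncomputable def Ad (g : L) : Module.End ℝ (EuclideanSpace ℝ (Fin n)) :=
  ContinuousLinearMap.toLinearMap
    (mfderiv (𝓡 n) (𝓡 n) (fun x : L ↦ g * x * g⁻¹) 1 :
      EuclideanSpace ℝ (Fin n) →L[ℝ] EuclideanSpace ℝ (Fin n))

variable (n) in
/-- The `Ad`-action of a one-parameter group is parabolic: it is by unipotent maps. -/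
def IsAdParabolic (γ : ℝ → L) : Prop :=
  ∀ t, IsNilpotent (Ad n (γ t) - 1)

variable (n) in
/-- The `Ad`-action of a one-parameter group is elliptic: it is by semisimple maps all of whose
complex eigenvalues have modulus one. -/
def IsAdElliptic (γ : ℝ → L) : Prop :=
  ∀ t, (Ad n (γ t)).IsSemisimple ∧
    ∀ z : ℂ, ((Ad n (γ t)).charpoly.map (algebraMap ℝ ℂ)).IsRoot z → ‖z‖ = 1

variable (n) in
/-- `f` is a diffeomorphism from the quotient manifold `L / G` onto `ℝ`. The smooth structure of
`L / G` is the one for which the projection from `L` is a smooth submersion, so this says that the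
homeomorphism `f` becomes a smooth submersion when it is composed with the projection. -/
structure IsQuotientDiffeo {G : Subgroup L} (f : L ⧸ G ≃ₜ ℝ) : Prop where
  contMDiff : ContMDiff (𝓡 n) 𝓘(ℝ, ℝ) ∞ (fun l : L ↦ f (l : L ⧸ G))
  surjective : ∀ l : L, Function.Surjective
    (mfderiv (𝓡 n) 𝓘(ℝ, ℝ) (fun l : L ↦ f (l : L ⧸ G)) l)

/-- The one-parameter group `γ` acts transitively on `L / G`. -/
def ActsTransitively (G : Subgroup L) (γ : ℝ → L) : Prop :=
  ∀ x y : L ⧸ G, ∃ t, γ t • x = y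

/-- The one-parameter group `γ` acts trivially on `L / G`. -/
def ActsTrivially (G : Subgroup L) (γ : ℝ → L) : Prop :=
  ∀ (t : ℝ) (x : L ⧸ G), γ t • x = x

end LieLine

/-!
The point is that `N` acts on the line `L / G` through an abelian group.  Since `N` is normal and
not contained in `G`, it fixes no point of `L / G`, and since it is generated by one-parameter
groups it then acts transitively, by increasing maps
(`OrderIso.exists_apply_eq_of_preconnected`).  If `g, n ∈ N` had a commutator `z` acting
nontrivially and centrally, then `z`, or its inverse, would move every point up; but conjugating
`n` by `g ^ k` produces `z ^ k * n` and cannot change the size of the displacement of `n` as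
measured by powers of `z` (`OrderIso.not_forall_lt_commutator`).  Hence the upper central series of
the nilpotent image of `N` stops at the centre, and the image is abelian
(`OrderIso.commute_of_isNilpotent`).

A transitive abelian action is free modulo its kernel, so some one-parameter group `γ` of `N` acts
simply transitively, and its orbit map is a coordinate `f` on `L / G`.  Elements of `L` normalize
`N`, so conjugation by `l` rescales the translations `γ t` by a factor `c l`, and in the coordinate
`f` the action of `l` is `x ↦ c l * x + F l` (`LieLine.exists_isAffineCoordinate`).  The continuous
functions `c` and `F` satisfy `c (l * m) = c l * c m` and `F (l * m) = c l * F m + F l`, and they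
are smooth because averaging them against a bump function for the Haar measure reproduces them
(`LieGroup.contMDiff_of_continuous_cocycle`).

The subgroups in question are `G = {F = 0}`, its normal core `{c = 1, F = 0}` and `Tr = {c = 1}`.
Their Lie algebras are the kernels of the differentials `α` of `c` and `β` of `F` at `1`, as every
tangent vector at `1` generates a one-parameter group (`LieLine.exists_isExpOf`).  The identity
`β [u, v] = α u * β v - α v * β u` gives the description of the Lie algebra of the core.  Finally,
if `c l ≠ 1` then `c l` is an eigenvalue of the transpose of `Ad l`
(`LieLine.IsAffineCoordinate.exists_eigenform`), which is impossible for unipotent maps, and for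
maps whose eigenvalues have modulus one because `c l > 0`.
-/

/-! ### Nilpotent groups of order automorphisms of a line -/

section Order

open scoped commutatorElement

variable {X : Type*} [ConditionallyCompleteLinearOrder X]

theorem OrderIso.exists_lt_pow_apply (z : X ≃o X) (hz : ∀ x, x < z x) (x y : X) :
    ∃ k : ℕ, y < (z ^ k) x := by
  by_contra! h
  have hne : (Set.range fun k : ℕ ↦ (z ^ k) x).Nonempty := ⟨_, 0, rfl⟩
  have hb : BddAbove (Set.range fun k : ℕ ↦ (z ^ k) x) := ⟨y, by rintro _ ⟨k, rfl⟩; exact h k⟩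
  have h1 : z (sSup (Set.range fun k : ℕ ↦ (z ^ k) x)) ≤ sSup (Set.range fun k : ℕ ↦ (z ^ k) x) := by
    rw [z.map_csSup' hne hb]
    refine csSup_le (hne.image _) ?_
    rintro _ ⟨_, ⟨k, rfl⟩, rfl⟩
    refine le_csSup hb ⟨k + 1, ?_⟩
    simp only [pow_succ', RelIso.mul_apply]
  exact absurd (hz _) (not_lt.mpr h1)

theorem OrderIso.exists_zpow_apply_le_lt (z : X ≃o X) (hz : ∀ x, x < z x) (x y : X) :
    ∃ j : ℤ, (z ^ j) x ≤ y ∧ y < (z ^ (j + 1)) x := by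
  obtain ⟨k, hk⟩ := z.exists_lt_pow_apply hz x y
  obtain ⟨m, hm⟩ := z.exists_lt_pow_apply hz y x
  have hmono : StrictMono fun j : ℤ ↦ (z ^ j) x := by
    refine strictMono_int_of_lt_succ fun j ↦ ?_
    rw [add_comm, zpow_add, zpow_one]
    exact hz _
  have hm' : (z ^ (-(m : ℤ))) x ≤ y := by
    have := (z ^ (-(m : ℤ))).lt_iff_lt.2 hm
    rw [← RelIso.mul_apply, ← zpow_natCast, ← zpow_add] at this
    simpa using this.le
  obtain ⟨j, hj, hj'⟩ := Int.exists_greatest_of_bdd (P := fun j : ℤ ↦ (z ^ j) x ≤ y)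
    ⟨k, fun j hj ↦ by
      by_contra! hlt
      have := hmono hlt
      simp only [zpow_natCast] at this
      exact absurd (this.trans_le hj) hk.not_gt⟩ ⟨_, hm'⟩
  exact ⟨j, hj, lt_of_not_ge fun h ↦ by linarith [hj' _ h]⟩

/-- A commutator of order automorphisms that is central cannot move every point up: conjugating by
powers of `g` keeps the displacement of `n` bounded in terms of `z`, while `g ^ k` conjugates `n`
to `z ^ k * n`. -/
theorem OrderIso.not_forall_lt_commutator (g n z : X ≃o X) (hgn : g * n = z * n * g)
    (hg : Commute z g) (hn : Commute z n) (x : X) : ¬ ∀ x, x < z x := by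
  intro hz
  have hconj : ∀ k : ℕ, g ^ k * n = z ^ k * n * g ^ k := by
    intro k
    induction k with
    | zero => simp
    | succ k ih =>
      rw [pow_succ' g, mul_assoc, ih, ← mul_assoc, ← mul_assoc, (hg.pow_left k).symm.eq,
        mul_assoc _ g n, hgn, pow_succ z]
      simp only [mul_assoc]
  -- `n` moves no point down further than `z ^ (m + 1)` does
  obtain ⟨m, hm⟩ := z.exists_lt_pow_apply hz (n x) x
  have hlow : ∀ y, y < (z ^ (m + 1)) (n y) := by
    intro y
    obtain ⟨j, hj, hj'⟩ := z.exists_zpow_apply_le_lt hz x y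
    have h1 : (z ^ j) (n x) ≤ n y := by
      have h2 := n.le_iff_le.2 hj
      rwa [← RelIso.mul_apply, ← (hn.zpow_left j).eq] at h2
    have h3 := (z ^ (j + 1)).lt_iff_lt.2 hm
    have h4 := (z ^ (m + 1)).le_iff_le.2 h1
    have h5 : (z ^ (m + 1)) ((z ^ j) (n x)) = (z ^ (j + 1)) ((z ^ m) (n x)) := by
      simp only [← RelIso.mul_apply, ← zpow_natCast, ← mul_assoc, ← zpow_add]
      congr 3
      push_cast
      ring
    exact hj'.trans (h3.trans_le (h5 ▸ h4))
  -- `n` moves no point up further than `z ^ l` at `x`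
  obtain ⟨l, hl⟩ := z.exists_lt_pow_apply hz x (n x)
  set k := l + (m + 1) with hk
  have h1 : (g ^ k) (n x) < (z ^ l) ((g ^ k) x) := by
    have h2 := (g ^ k).lt_iff_lt.2 hl
    rwa [← RelIso.mul_apply (g ^ k) (z ^ l), ← (hg.pow_pow l k).eq] at h2
  rw [← RelIso.mul_apply, hconj, RelIso.mul_apply, RelIso.mul_apply, hk, pow_add,
    RelIso.mul_apply] at h1
  exact absurd ((z ^ l).lt_iff_lt.1 h1) (hlow _).not_gt

/-- In a transitive group of order automorphisms, a central element with a fixed point is trivial, so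
a nontrivial central commutator would be fixed-point free, which
`OrderIso.not_forall_lt_commutator` forbids. -/
theorem OrderIso.commute_of_commutator_mem_center (S : Subgroup (X ≃o X))
    (htrans : ∀ x y, ∃ s ∈ S, s x = y) {g n : X ≃o X} (hg : g ∈ S) (hn : n ∈ S)
    (hz : ∀ s ∈ S, Commute ⁅g, n⁆ s) : Commute g n := by
  by_contra hne
  have key : ∀ g ∈ S, ∀ n ∈ S, (∀ s ∈ S, Commute ⁅g, n⁆ s) → ∀ x, ¬ x < ⁅g, n⁆ x := by
    intro g hg n hn hz x hx
    refine OrderIso.not_forall_lt_commutator g n ⁅g, n⁆ (by simp [commutatorElement_def])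
      (hz g hg) (hz n hn) x fun y ↦ ?_
    obtain ⟨s, hs, rfl⟩ := htrans x y
    rw [← RelIso.mul_apply, (hz s hs).eq, RelIso.mul_apply]
    exact s.lt_iff_lt.2 hx
  have hz' : ∀ s ∈ S, Commute ⁅n, g⁆ s := fun s hs ↦ by
    rw [← commutatorElement_inv]
    exact (hz s hs).inv_left
  refine hne (commutatorElement_eq_one_iff_commute.1 ?_)
  ext x
  refine le_antisymm (not_lt.1 (key g hg n hn hz x)) (not_lt.1 fun hlt ↦ ?_)
  refine key n hn g hg hz' (⁅g, n⁆ x) ?_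
  rwa [← RelIso.mul_apply, ← commutatorElement_inv g n, inv_mul_cancel, RelIso.one_apply]

/-- A nilpotent group acting transitively on a line by order automorphisms acts through an abelian
group. -/
theorem OrderIso.commute_of_isNilpotent {Γ : Type*} [Group Γ] [Group.IsNilpotent Γ]
    (φ : Γ →* (X ≃o X)) (htrans : ∀ x y, ∃ g, φ g x = y) (g h : Γ) : Commute (φ g) (φ h) := by
  have : Group.IsNilpotent φ.range :=
    Group.nilpotent_of_surjective φ.rangeRestrict φ.rangeRestrict_surjective
  have htrans' : ∀ x y, ∃ s ∈ φ.range, s x = y := fun x y ↦ by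
    obtain ⟨g, hg⟩ := htrans x y
    exact ⟨φ g, ⟨g, rfl⟩, hg⟩
  have hcs : ∀ k, Subgroup.upperCentralSeries φ.range k ≤ Subgroup.center φ.range := by
    intro k
    induction k with
    | zero => simp
    | succ k ih =>
      intro a ha
      rw [Subgroup.mem_center_iff]
      intro b
      have hab := ih (Subgroup.mem_upperCentralSeries_succ_iff.1 ha b)
      rw [Subgroup.mem_center_iff] at hab
      refine Subtype.ext (OrderIso.commute_of_commutator_mem_center φ.range htrans' a.2 b.2
        fun s hs ↦ ?_).symm.eq
      have := congrArg Subtype.val (hab ⟨s, hs⟩)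
      exact this.symm
  obtain ⟨k, hk⟩ := Group.IsNilpotent.nilpotent (G := φ.range)
  have hmem : (⟨φ g, g, rfl⟩ : φ.range) ∈ Subgroup.center φ.range := hcs k (hk ▸ Subgroup.mem_top _)
  exact (congrArg Subtype.val (Subgroup.mem_center_iff.1 hmem ⟨φ h, h, rfl⟩)).symm

/-- A group of order automorphisms of a line, generated by elements that move each point within a
connected part of its orbit, has a global fixed point or is transitive. -/
theorem OrderIso.exists_apply_eq_of_preconnected [TopologicalSpace X] [OrderTopology X]
    {Γ : Type*} [Group Γ] (φ : Γ →* (X ≃o X)) (S : Set Γ) (hS : Subgroup.closure S = ⊤)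
    (hconn : ∀ s ∈ S, ∀ x, ∃ C : Set X, IsPreconnected C ∧ x ∈ C ∧ φ s x ∈ C ∧
      ∀ y ∈ C, ∃ g, φ g x = y)
    (hfix : ∀ x, ∃ g, φ g x ≠ x) (x y : X) : ∃ g, φ g x = y := by
  by_contra! hy
  -- no generator moves a point of the orbit of `x` across `y`
  have hside : ∀ s ∈ S, ∀ g, φ (s * g) x < y ↔ φ g x < y := by
    intro s hs g
    obtain ⟨C, hC, h1, h2, h3⟩ := hconn s hs (φ g x)
    have hyC : y ∉ C := fun h ↦ by
      obtain ⟨g', hg'⟩ := h3 y h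
      exact hy (g' * g) (by simpa using hg')
    rw [map_mul, RelIso.mul_apply]
    constructor <;> intro h <;> by_contra! h'
    · exact hyC (hC.ordConnected.out h2 h1 ⟨h.le, h'⟩)
    · exact hyC (hC.ordConnected.out h1 h2 ⟨h.le, h'⟩)
  have hall : ∀ g g', φ (g * g') x < y ↔ φ g' x < y := by
    intro g
    have hg : g ∈ Subgroup.closure S := hS ▸ Subgroup.mem_top g
    induction hg using Subgroup.closure_induction with
    | mem s hs => exact hside s hs
    | one => simp
    | mul a b _ _ ha hb => intro g'; rw [mul_assoc, ha, hb]
    | inv a _ ha => intro g'; rw [← ha (a⁻¹ * g'), mul_inv_cancel_left]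
  have hall' : ∀ g, φ g x < y ↔ x < y := fun g ↦ by simpa using hall g 1
  have hne : (Set.range fun g ↦ φ g x).Nonempty := ⟨_, 1, rfl⟩
  have him : ∀ g, φ g '' (Set.range fun g ↦ φ g x) = Set.range fun g ↦ φ g x := by
    intro g
    ext z
    constructor
    · rintro ⟨_, ⟨g', rfl⟩, rfl⟩
      exact ⟨g * g', by simp⟩
    · rintro ⟨g', rfl⟩
      exact ⟨_, ⟨g⁻¹ * g', rfl⟩, by simp⟩
  by_cases hxy : x < y
  · have hb : BddAbove (Set.range fun g ↦ φ g x) :=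
      ⟨y, by rintro _ ⟨g, rfl⟩; exact ((hall' g).2 hxy).le⟩
    obtain ⟨g, hg⟩ := hfix (sSup (Set.range fun g ↦ φ g x))
    exact hg (by rw [(φ g).map_csSup' hne hb, him])
  · have hb : BddBelow (Set.range fun g ↦ φ g x) :=
      ⟨y, by rintro _ ⟨g, rfl⟩; exact not_lt.1 fun h ↦ hxy ((hall' g).1 h)⟩
    obtain ⟨g, hg⟩ := hfix (sInf (Set.range fun g ↦ φ g x))
    exact hg (by rw [(φ g).map_csInf' hne hb, him])

end Order

/-! ### One-parameter groups acting on a quotient homeomorphic to the line -/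

theorem Continuous.isHomeomorph_of_bijective_real {ψ : ℝ → ℝ} (hc : Continuous ψ)
    (hb : Function.Bijective ψ) : IsHomeomorph ψ := by
  rcases hc.strictMono_of_inj hb.1 with hm | hm
  · exact (hm.orderIsoOfSurjective ψ hb.2).toHomeomorph.isHomeomorph
  · have hm' : StrictMono fun t ↦ ψ (-t) := fun s t hst ↦ hm (neg_lt_neg hst)
    have hs' : Function.Surjective fun t ↦ ψ (-t) := hb.2.comp neg_surjective
    have h1 := ((Homeomorph.neg ℝ).trans
      (hm'.orderIsoOfSurjective _ hs').toHomeomorph).isHomeomorph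
    convert h1 using 1
    ext t
    simp

namespace LieLine

/-- A normal subgroup not contained in `G` fixes no point of `L ⧸ G`: conjugation moves any
stabilizer to `G`. -/
theorem exists_smul_ne_of_not_le {L : Type*} [Group L] {G N : Subgroup L} (hNn : N.Normal)
    (hNG : ¬ N ≤ G) (x : L ⧸ G) : ∃ n ∈ N, n • x ≠ x := by
  by_contra! hfix
  obtain ⟨l, rfl⟩ := QuotientGroup.mk_surjective x
  refine hNG fun n hn ↦ ?_
  have h1 := hfix _ (hNn.conj_mem n hn l)
  rw [← QuotientGroup.mk_mul_of_mem l (G.one_mem), MulAction.Quotient.smul_mk, eq_comm,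
    QuotientGroup.eq] at h1
  simpa [mul_assoc] using h1

section Line

variable {L : Type*} [TopologicalSpace L] [Group L]

theorem IsOneParameterGroup.map_zero {γ : ℝ → L} (hγ : IsOneParameterGroup γ) : γ 0 = 1 := by
  simpa using hγ.map_add 0 0

variable {G : Subgroup L}

/-- The action of a group on a space homeomorphic to the line, by increasing maps, transported to
the line. -/
def lineAction (h : L ⧸ G ≃ₜ ℝ) {Γ : Type*} [Group Γ] (j : Γ →* L)
    (hj : ∀ g, StrictMono fun x : ℝ ↦ h (j g • h.symm x)) : Γ →* (ℝ ≃o ℝ) where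
  toFun g :=
    { toEquiv := (h.symm.toEquiv.trans (MulAction.toPerm (j g))).trans h.toEquiv
      map_rel_iff' := (hj g).le_iff_le }
  map_one' := by
    ext x
    simp
  map_mul' a b := by
    ext x
    change h (j (a * b) • h.symm x) = h (j a • h.symm (h (j b • h.symm x)))
    simp [mul_smul]

theorem lineAction_apply (h : L ⧸ G ≃ₜ ℝ) {Γ : Type*} [Group Γ] (j : Γ →* L)
    (hj : ∀ g, StrictMono fun x : ℝ ↦ h (j g • h.symm x)) (g : Γ) (x : ℝ) :
    lineAction h j hj g x = h (j g • h.symm x) := rfl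

variable [IsTopologicalGroup L]

theorem strictMono_smul_of_mem_closure (h : L ⧸ G ≃ₜ ℝ) {N : Subgroup L} {𝒮 : Set (ℝ → L)}
    (h𝒮 : ∀ γ ∈ 𝒮, IsOneParameterGroup γ)
    (hN : N = Subgroup.closure {g | ∃ γ ∈ 𝒮, γ 1 = g}) {n : L} (hn : n ∈ N) :
    StrictMono fun x : ℝ ↦ h (n • h.symm x) := by
  subst hN
  induction hn using Subgroup.closure_induction with
  | one => simpa using! (strictMono_id : StrictMono (id : ℝ → ℝ))
  | mul a b _ _ ha hb =>
    have := ha.comp hb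
    simpa [Function.comp_def, mul_smul] using this
  | inv a _ ha =>
    intro x y hxy
    by_contra! hle
    have h1 := ha.monotone hle
    simp only [Homeomorph.symm_apply_apply, smul_inv_smul, Homeomorph.apply_symm_apply] at h1
    exact absurd hxy h1.not_gt
  | mem a ha =>
    obtain ⟨γ, hγ, rfl⟩ := ha
    -- `γ 1` is the square of `γ (1 / 2)`, so it preserves the orientation
    have h2 : γ 1 = γ (1 / 2) * γ (1 / 2) := by
      rw [← (h𝒮 γ hγ).map_add]; norm_num
    have hc : Continuous fun x : ℝ ↦ h (γ (1 / 2) • h.symm x) := by fun_prop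
    have hinj : Function.Injective fun x : ℝ ↦ h (γ (1 / 2) • h.symm x) :=
      h.injective.comp ((MulAction.injective _).comp h.symm.injective)
    have h3 : (fun x : ℝ ↦ h (γ 1 • h.symm x)) =
        (fun x : ℝ ↦ h (γ (1 / 2) • h.symm x)) ∘ fun x : ℝ ↦ h (γ (1 / 2) • h.symm x) := by
      ext x
      simp [h2, mul_smul]
    rw [h3]
    rcases hc.strictMono_of_inj hinj with hm | hm
    · exact hm.comp hm
    · exact hm.comp hm

theorem exists_smul_eq_of_normal (h : L ⧸ G ≃ₜ ℝ) {N : Subgroup L} (hNn : N.Normal) (hNG : ¬ N ≤ G)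
    {𝒮 : Set (ℝ → L)} (h𝒮 : ∀ γ ∈ 𝒮, IsOneParameterGroup γ) (h𝒮N : ∀ γ ∈ 𝒮, ∀ t, γ t ∈ N)
    (hN : N = Subgroup.closure {g | ∃ γ ∈ 𝒮, γ 1 = g}) (x y : L ⧸ G) : ∃ n ∈ N, n • x = y := by
  have hmono : ∀ n : N, StrictMono fun x : ℝ ↦ h (N.subtype n • h.symm x) :=
    fun n ↦ strictMono_smul_of_mem_closure h h𝒮 hN n.2
  have hgen : Subgroup.closure (Subtype.val ⁻¹' {g | ∃ γ ∈ 𝒮, γ 1 = g}) = (⊤ : Subgroup N) := by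
    have h1 := Subgroup.closure_closure_coe_preimage (k := {g | ∃ γ ∈ 𝒮, γ 1 = g})
    rwa [← hN] at h1
  have horbit : ∀ x y : ℝ, ∃ n, lineAction h N.subtype hmono n x = y := by
    refine OrderIso.exists_apply_eq_of_preconnected _ _ hgen ?_ ?_
    · rintro ⟨_, hs⟩ ⟨γ, hγ, rfl⟩ z
      have hγc := (h𝒮 γ hγ).continuous
      refine ⟨Set.range fun t ↦ h (γ t • h.symm z), isPreconnected_range (by fun_prop),
        ⟨0, by simp [(h𝒮 γ hγ).map_zero]⟩, ⟨1, rfl⟩, ?_⟩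
      rintro _ ⟨t, rfl⟩
      exact ⟨⟨γ t, h𝒮N γ hγ t⟩, rfl⟩
    · intro z
      obtain ⟨n, hn, hne⟩ := exists_smul_ne_of_not_le hNn hNG (h.symm z)
      refine ⟨⟨n, hn⟩, fun heq ↦ hne ?_⟩
      rw [lineAction_apply] at heq
      simpa using congrArg h.symm heq
  obtain ⟨n, hn⟩ := horbit (h x) (h y)
  rw [lineAction_apply, h.symm_apply_apply] at hn
  exact ⟨n, n.2, h.injective hn⟩

/-- A normal nilpotent subgroup generated by one-parameter groups and not contained in `G` acts on
the line `L ⧸ G` through an abelian group: its image is a transitive nilpotent group of order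
automorphisms. -/
theorem smul_smul_comm_of_isNilpotent (h : L ⧸ G ≃ₜ ℝ) {N : Subgroup L} (hNn : N.Normal)
    (hNnil : Group.IsNilpotent N) (hNG : ¬ N ≤ G)
    {𝒮 : Set (ℝ → L)} (h𝒮 : ∀ γ ∈ 𝒮, IsOneParameterGroup γ) (h𝒮N : ∀ γ ∈ 𝒮, ∀ t, γ t ∈ N)
    (hN : N = Subgroup.closure {g | ∃ γ ∈ 𝒮, γ 1 = g}) {n m : L} (hn : n ∈ N) (hm : m ∈ N)
    (x : L ⧸ G) : n • m • x = m • n • x := by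
  have hmono : ∀ n : N, StrictMono fun x : ℝ ↦ h (N.subtype n • h.symm x) :=
    fun n ↦ strictMono_smul_of_mem_closure h h𝒮 hN n.2
  have h1 := OrderIso.commute_of_isNilpotent (lineAction h N.subtype hmono) (fun x y ↦ by
    obtain ⟨n, hn, hnx⟩ := exists_smul_eq_of_normal h hNn hNG h𝒮 h𝒮N hN (h.symm x) (h.symm y)
    exact ⟨⟨n, hn⟩, by simp [lineAction_apply, hnx]⟩) ⟨n, hn⟩ ⟨m, hm⟩
  have h2 := congrArg (fun e : ℝ ≃o ℝ ↦ h.symm (e (h x))) h1.eq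
  simpa [lineAction_apply] using h2

/-- A one-parameter group acting without fixed points on a line acts simply transitively, and its
orbit maps are homeomorphisms. -/
theorem IsOneParameterGroup.isHomeomorph_smul (h : L ⧸ G ≃ₜ ℝ) {γ : ℝ → L} (hγ : IsOneParameterGroup γ)
    (hfree : ∀ t, ∀ x : L ⧸ G, γ t • x = x → ∀ y : L ⧸ G, γ t • y = y)
    (hne : ∃ t, ∃ x : L ⧸ G, γ t • x ≠ x) (x : L ⧸ G) :
    IsHomeomorph fun t ↦ γ t • x := by
  have hγc := hγ.continuous
  let j : Multiplicative ℝ →* L :=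
    { toFun := fun t ↦ γ t.toAdd
      map_one' := hγ.map_zero
      map_mul' := fun s t ↦ hγ.map_add _ _ }
  have hmono : ∀ g, StrictMono fun x : ℝ ↦ h (j g • h.symm x) := fun g ↦
    strictMono_smul_of_mem_closure (𝒮 := {γ' | IsOneParameterGroup γ'}) h (fun _ hγ' ↦ hγ') rfl
      (Subgroup.subset_closure ⟨fun t : ℝ ↦ γ (t * Multiplicative.toAdd g),
        ⟨by fun_prop, fun s t ↦ by rw [add_mul, hγ.map_add]⟩, by simp; rfl⟩)
  have hsurj : Function.Surjective fun t ↦ γ t • x := by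
    have horbit : ∀ x y : ℝ, ∃ n, lineAction h j hmono n x = y := by
      refine OrderIso.exists_apply_eq_of_preconnected _ Set.univ Subgroup.closure_univ ?_ ?_
      · intro s _ z
        refine ⟨Set.range fun t ↦ h (γ t • h.symm z), isPreconnected_range (by fun_prop),
          ⟨0, by simp [hγ.map_zero]⟩, ⟨s.toAdd, rfl⟩, ?_⟩
        rintro _ ⟨t, rfl⟩
        exact ⟨Multiplicative.ofAdd t, rfl⟩
      · intro z
        by_contra! hz
        obtain ⟨t, y, hty⟩ := hne
        refine hty (hfree t (h.symm z) ?_ y)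
        have h1 := hz (Multiplicative.ofAdd t)
        rw [lineAction_apply] at h1
        simpa [j] using congrArg h.symm h1
    intro y
    obtain ⟨t, ht⟩ := horbit (h x) (h y)
    rw [lineAction_apply, h.symm_apply_apply] at ht
    exact ⟨t.toAdd, h.injective ht⟩
  have hinj : Function.Injective fun t ↦ γ t • x := by
    intro s t hst
    by_contra hne'
    have h0 : γ (t - s) • x = x := by
      have h1 : γ (t - s) = (γ s)⁻¹ * γ t := by
        rw [eq_inv_mul_iff_mul_eq, ← hγ.map_add, add_sub_cancel]
      rw [h1, mul_smul, ← show γ s • x = γ t • x from hst, inv_smul_smul]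
    have hper : Function.Periodic (fun t ↦ h (γ t • x)) (t - s) := fun r ↦ by
      simp only [hγ.map_add, mul_smul, h0]
    have hcomp := hper.compact_of_continuous (sub_ne_zero.2 (Ne.symm hne')) (by fun_prop)
    rw [show Set.range (fun t ↦ h (γ t • x)) = Set.univ from (h.surjective.comp hsurj).range_eq]
      at hcomp
    exact noncompact_univ ℝ hcomp
  have h1 := Continuous.isHomeomorph_of_bijective_real (ψ := fun t ↦ h (γ t • x)) (by fun_prop)
    ⟨h.injective.comp hinj, h.surjective.comp hsurj⟩
  have h2 := h.symm.isHomeomorph.comp h1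
  simpa [Function.comp_def] using h2

end Line
end LieLine

/-! ### The affine coordinate on the quotient -/

namespace LieLine

section Line

variable {L : Type*} [TopologicalSpace L] [Group L] {G : Subgroup L}

/-- `f` is a coordinate on `L / G`, vanishing at the base point, in which the action of `l` is the
increasing affine map `x ↦ c l * x + F l`. -/
structure IsAffineCoordinate (f : L ⧸ G ≃ₜ ℝ) (c F : L → ℝ) : Prop where
  slope_pos : ∀ l, 0 < c l
  apply_smul : ∀ (l : L) (x : L ⧸ G), f (l • x) = c l * f x + F l
  apply_one : f (1 : L) = 0

namespace IsAffineCoordinate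

variable {f : L ⧸ G ≃ₜ ℝ} {c F : L → ℝ}

theorem apply_coe (hf : IsAffineCoordinate f c F) (l : L) : f l = F l := by
  have h1 := hf.apply_smul l (1 : L)
  rwa [hf.apply_one, mul_zero, zero_add, MulAction.Quotient.smul_coe, smul_eq_mul, mul_one] at h1

theorem intercept_mul (hf : IsAffineCoordinate f c F) (l m : L) :
    F (l * m) = c l * F m + F l := by
  rw [← hf.apply_coe, ← hf.apply_coe m, ← hf.apply_smul, MulAction.Quotient.smul_coe, smul_eq_mul]

theorem slope_mul (hf : IsAffineCoordinate f c F) (l m : L) : c (l * m) = c l * c m := by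
  have h1 := hf.apply_smul (l * m) (f.symm 1)
  rw [mul_smul, hf.apply_smul, hf.apply_smul, f.apply_symm_apply, hf.intercept_mul] at h1
  linarith

theorem slope_one (hf : IsAffineCoordinate f c F) : c 1 = 1 := by
  have h1 := hf.slope_mul 1 1
  rw [mul_one] at h1
  exact (mul_eq_left₀ (hf.slope_pos 1).ne').1 h1.symm

theorem intercept_one (hf : IsAffineCoordinate f c F) : F 1 = 0 := by
  rw [← hf.apply_coe, hf.apply_one]

theorem mem_iff (hf : IsAffineCoordinate f c F) (l : L) : l ∈ G ↔ F l = 0 := by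
  rw [← hf.apply_coe, ← hf.apply_one, f.injective.eq_iff, eq_comm, QuotientGroup.eq]
  simp

theorem continuous_intercept (hf : IsAffineCoordinate f c F) : Continuous F := by
  simp_rw [← funext hf.apply_coe]
  exact f.continuous.comp continuous_quotient_mk'

theorem smul_eq_self_iff (hf : IsAffineCoordinate f c F) (l : L) :
    (∀ x : L ⧸ G, l • x = x) ↔ c l = 1 ∧ F l = 0 := by
  constructor
  · intro h
    have h0 : F l = 0 := by
      have := hf.apply_smul l (1 : L)
      rw [h, hf.apply_one] at this
      linarith
    have h1 := hf.apply_smul l (f.symm 1)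
    rw [h, f.apply_symm_apply, h0] at h1
    exact ⟨by linarith, h0⟩
  · rintro ⟨h1, h0⟩ x
    apply f.injective
    rw [hf.apply_smul, h1, h0, one_mul, add_zero]

end IsAffineCoordinate

/-- If a normal nilpotent subgroup `N`, generated by one-parameter groups, is not contained in the
connected group `G` and `L / G` is a line, then `L` acts on `L / G` by affine maps in the
coordinate given by the orbit of one of these one-parameter groups. -/
theorem exists_isAffineCoordinate [IsTopologicalGroup L] (h : L ⧸ G ≃ₜ ℝ)
    (hG : IsConnected (G : Set L)) {N : Subgroup L} (hNn : N.Normal)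
    (hNnil : Group.IsNilpotent N) (hNG : ¬ N ≤ G)
    {𝒮 : Set (ℝ → L)} (h𝒮 : ∀ γ ∈ 𝒮, IsOneParameterGroup γ) (h𝒮N : ∀ γ ∈ 𝒮, ∀ t, γ t ∈ N)
    (hN : N = Subgroup.closure {g | ∃ γ ∈ 𝒮, γ 1 = g}) :
    ∃ (f : L ⧸ G ≃ₜ ℝ) (c F : L → ℝ), IsAffineCoordinate f c F ∧ Continuous c ∧
      (∀ n ∈ N, c n = 1) ∧ ∃ γ ∈ 𝒮, ∀ t, F (γ t) = t := by
  have htrans := exists_smul_eq_of_normal h hNn hNG h𝒮 h𝒮N hN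
  have hcomm : ∀ {n m}, n ∈ N → m ∈ N → ∀ x : L ⧸ G, n • m • x = m • n • x := fun hn hm x ↦
    smul_smul_comm_of_isNilpotent h hNn hNnil hNG h𝒮 h𝒮N hN hn hm x
  -- an abelian transitive group acts freely, up to its kernel
  have hfree : ∀ n ∈ N, ∀ x : L ⧸ G, n • x = x → ∀ y : L ⧸ G, n • y = y := by
    intro n hn x hx y
    obtain ⟨m, hm, rfl⟩ := htrans x y
    rw [hcomm hn hm, hx]
  obtain ⟨γ, hγ𝒮, hγne⟩ : ∃ γ ∈ 𝒮, ∃ t, ∃ x : L ⧸ G, γ t • x ≠ x := by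
    by_contra! hall
    obtain ⟨n, hn, hne⟩ := exists_smul_ne_of_not_le hNn hNG ((1 : L) : L ⧸ G)
    have hle : N ≤ MulAction.stabilizer L ((1 : L) : L ⧸ G) := by
      rw [hN, Subgroup.closure_le]
      rintro _ ⟨γ, hγ, rfl⟩
      exact hall γ hγ 1 _
    exact hne (hle hn)
  have hγ := h𝒮 γ hγ𝒮
  have hγN := h𝒮N γ hγ𝒮
  have hγc := hγ.continuous
  set x₀ : L ⧸ G := ((1 : L) : L ⧸ G) with hx₀
  set f : L ⧸ G ≃ₜ ℝ :=
    (hγ.isHomeomorph_smul h (fun t ↦ hfree _ (hγN t)) hγne x₀).homeomorph.symm with hfdef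
  have hfγ : ∀ t, f (γ t • x₀) = t := fun t ↦
    (hγ.isHomeomorph_smul h (fun t ↦ hfree _ (hγN t)) hγne x₀).homeomorph.symm_apply_apply t
  have hγf : ∀ x, γ (f x) • x₀ = x := fun x ↦ f.injective (hfγ _)
  have hconj : ∀ l t, l * γ t * l⁻¹ ∈ N := fun l t ↦ hNn.conj_mem _ (hγN t) l
  -- `τ l` is the effect of conjugation by `l` on the translations by the one-parameter group `γ`
  set τ : L → ℝ → ℝ := fun l t ↦ f ((l * γ t * l⁻¹) • x₀) with hτdef
  have hτ : ∀ l t, γ (τ l t) • x₀ = (l * γ t * l⁻¹) • x₀ := fun l t ↦ hγf _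
  have hadd : ∀ l s t, τ l (s + t) = τ l s + τ l t := by
    intro l s t
    have h1 : (l * γ (s + t) * l⁻¹) • x₀ = γ (τ l s + τ l t) • x₀ := by
      rw [hγ.map_add, add_comm, hγ.map_add, mul_smul (γ (τ l t)), hτ, hcomm (hγN _) (hconj l s),
        hτ, ← mul_smul]
      congr 1
      group
    rw [hτdef]
    simp only
    rw [h1, hfγ]
  have hlin : ∀ l t, τ l t = τ l 1 * t := by
    intro l t
    have hcont : Continuous (τ l) := by
      have : Continuous fun t ↦ (l * γ t * l⁻¹) • x₀ := by fun_prop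
      exact f.continuous.comp this
    have h1 := map_real_smul (AddMonoidHom.mk' (τ l) (hadd l)) hcont t 1
    simpa [mul_comm] using h1
  have hsmul : ∀ (l : L) (x : L ⧸ G), f (l • x) = τ l 1 * f x + f (l • x₀) := by
    intro l x
    have h1 : l • x = γ (τ l (f x) + f (l • x₀)) • x₀ := by
      rw [add_comm, hγ.map_add, mul_smul, hτ, hcomm (hγN _) (hconj l _), hγf, ← mul_smul,
        inv_mul_cancel_right, mul_smul, hγf]
    rw [h1, hfγ, hlin l (f x)]
  have hf0 : f x₀ = 0 := by simpa [hγ.map_zero] using hfγ 0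
  have hne : ∀ l, τ l 1 ≠ 0 := by
    intro l h0
    have h1 := hτ l 1
    rw [h0, hγ.map_zero, one_smul] at h1
    have h2 := hfree _ (hconj l 1) _ h1.symm (l • x₀)
    rw [← mul_smul, inv_mul_cancel_right, mul_smul, smul_left_cancel_iff] at h2
    have h3 := hfγ 1
    rw [h2, hf0] at h3
    exact zero_ne_one h3
  have hmul : ∀ l m, τ (l * m) 1 = τ l 1 * τ m 1 := by
    intro l m
    have h1 := hsmul (l * m) (γ 1 • x₀)
    have h2 := hsmul l (m • x₀)
    rw [mul_smul, mul_smul, hsmul l, hsmul m, hfγ, h2] at h1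
    linarith
  have hτN : ∀ n ∈ N, τ n 1 = 1 := by
    intro n hn
    have h1 : (n * γ 1 * n⁻¹) • x₀ = γ 1 • x₀ := by
      rw [mul_smul, mul_smul, hcomm hn (hγN 1), smul_inv_smul]
    rw [hτdef]
    simp only
    rw [h1, hfγ]
  have hτc : Continuous fun l ↦ τ l 1 := by
    have : Continuous fun l : L ↦ (l * γ 1 * l⁻¹) • x₀ := by fun_prop
    exact f.continuous.comp this
  have hposG : ∀ g ∈ G, 0 < τ g 1 := by
    intro g hg
    by_contra! hle
    have h1 := (hG.isPreconnected.image _ hτc.continuousOn).ordConnected.out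
      (Set.mem_image_of_mem _ hg) (Set.mem_image_of_mem _ G.one_mem)
      (show (0 : ℝ) ∈ Set.Icc _ _ from ⟨hle, by simp [hτN 1 N.one_mem]⟩)
    obtain ⟨l, -, hl⟩ := h1
    exact hne l hl
  refine ⟨f, fun l ↦ τ l 1, fun l ↦ f (l • x₀), ⟨fun l ↦ ?_, hsmul, hf0⟩, hτc, hτN, γ, hγ𝒮, hfγ⟩
  obtain ⟨n, hn, hnl⟩ := htrans x₀ (l • x₀)
  have hg : n⁻¹ * l ∈ G := by
    rw [hx₀, MulAction.Quotient.smul_coe, MulAction.Quotient.smul_coe, QuotientGroup.eq] at hnl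
    simpa using hnl
  have h1 := hmul n (n⁻¹ * l)
  rw [mul_inv_cancel_left, hτN n hn, one_mul] at h1
  rw [h1]
  exact hposG _ hg

end Line
end LieLine

/-! ### Smoothness of continuous homomorphisms to the affine group -/

section Smoothing

open MeasureTheory Set

variable {E : Type*} [NormedAddCommGroup E] [NormedSpace ℝ E] [FiniteDimensional ℝ E]
  {L : Type*} [TopologicalSpace L] [ChartedSpace E L] [Group L] [LieGroup 𝓘(ℝ, E) ∞ L]

/-- On a Lie group the left translates of a continuous function, averaged against a suitable bump
function, depend smoothly on the translation near `1`: after a translation of the Haar measure, the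
parameter only enters through the bump function. -/
theorem LieGroup.exists_contMDiffAt_integral_mul [IsTopologicalGroup L] [T2Space L]
    [MeasurableSpace L] [BorelSpace L] (μ : Measure L) [μ.IsHaarMeasure] :
    ∃ χ : L → ℝ, Continuous χ ∧ HasCompactSupport χ ∧ 0 ≤ χ ∧ χ 1 = 1 ∧
      ∀ φ : L → ℝ, Continuous φ →
        ContMDiffAt 𝓘(ℝ, E) 𝓘(ℝ, ℝ) ∞ (fun l ↦ ∫ y, χ y * φ (l * y) ∂μ) 1 := by
  have : LocallyCompactSpace L := Manifold.locallyCompact_of_finiteDimensional 𝓘(ℝ, E)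
  borelize E
  set e := chartAt E (1 : L) with he
  have h1e : (1 : L) ∈ e.source := mem_chart_source E 1
  obtain ⟨K, hK, h1K, hKe⟩ := exists_compact_subset e.open_source h1e
  obtain ⟨V, hVo, h1V, hVV⟩ :=
    exists_open_nhds_one_mul_subset (isOpen_interior.mem_nhds h1K)
  obtain ⟨χ, -, hχV⟩ := (SmoothBumpFunction.nhds_basis_tsupport (I := 𝓘(ℝ, E)) (1 : L)).mem_iff.1
    (hVo.mem_nhds h1V)
  refine ⟨χ, χ.continuous, χ.hasCompactSupport, fun _ ↦ χ.nonneg, χ.eq_one, fun φ hφ ↦ ?_⟩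
  have hχ0 : ∀ l ∈ V, ∀ y ∉ K, χ (l⁻¹ * y) = 0 := by
    intro l hl y hy
    by_contra hne
    have h1 : l⁻¹ * y ∈ V := hχV (subset_tsupport _ hne)
    exact hy (interior_subset (hVV ⟨l, hl, _, h1, by simp⟩))
  have heK : ContinuousOn e K := e.continuousOn.mono hKe
  have hKc : IsCompact (e '' K) := hK.image_of_continuousOn heK
  have hKt : e '' K ⊆ e.target := by
    rintro _ ⟨y, hy, rfl⟩
    exact e.map_source (hKe hy)
  have hme : AEMeasurable e (μ.restrict K) := heK.aemeasurable hK.measurableSet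
  -- the Haar measure near `1`, seen in the chart
  set ν : Measure E := (μ.restrict K).map e with hν
  have : IsFiniteMeasure (μ.restrict K) := ⟨by simpa using hK.measure_lt_top⟩
  have : IsFiniteMeasure ν := by rw [hν]; infer_instance
  set φ' : E → ℝ := (e '' K).indicator (φ ∘ e.symm) with hφ'
  have hφ'i : LocallyIntegrable φ' ν := by
    have h1 : IntegrableOn (φ ∘ e.symm) (e '' K) ν :=
      (hφ.comp_continuousOn (e.continuousOn_symm.mono hKt)).integrableOn_compact hKc
    exact (h1.integrable_indicator hKc.measurableSet).locallyIntegrable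
  set W : Set E := e.target ∩ e.symm ⁻¹' V with hW
  have hWo : IsOpen W := e.symm.isOpen_inter_preimage hVo
  set g : E → E → ℝ := fun p x ↦ (e '' K).indicator (fun z ↦ χ ((e.symm p)⁻¹ * e.symm z)) (-x)
    with hg
  have hg0 : ∀ p, ∀ x, p ∈ W → x ∉ -(e '' K) → g p x = 0 := by
    intro p x _ hx
    exact indicator_of_notMem (by simpa using hx) _
  have hgs : ContDiffOn ℝ ∞ (Function.uncurry g) (W ×ˢ univ) := by
    rintro ⟨p, x⟩ ⟨hp, -⟩
    refine ContDiffAt.contDiffWithinAt ?_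
    by_cases hx : -x ∈ e.target
    · have h1 : (fun q : E × E ↦ χ ((e.symm q.1)⁻¹ * e.symm (-q.2))) =ᶠ[nhds (p, x)]
          Function.uncurry g := by
        have hx' : (-e.target) ∈ nhds x := (e.open_target.neg).mem_nhds hx
        filter_upwards [prod_mem_nhds (hWo.mem_nhds hp) hx'] with q hq
        simp only [Function.uncurry, hg]
        by_cases hqK : -q.2 ∈ e '' K
        · rw [indicator_of_mem hqK]
        · rw [indicator_of_notMem hqK]
          refine hχ0 _ hq.1.2 _ fun hmem ↦ hqK ?_
          exact ⟨_, hmem, e.right_inv hq.2⟩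
      refine ContDiffAt.congr_of_eventuallyEq ?_ h1.symm
      rw [← contMDiffAt_iff_contDiffAt]
      have hes : ∀ z ∈ e.target, ContMDiffAt 𝓘(ℝ, E) 𝓘(ℝ, E) ∞ e.symm z := fun z hz ↦
        contMDiffOn_chart_symm.contMDiffAt (e.open_target.mem_nhds hz)
      have h2 : ContMDiffAt 𝓘(ℝ, E × E) 𝓘(ℝ, E) ∞ (fun q : E × E ↦ e.symm q.1) (p, x) :=
        (hes p hp.1).comp (p, x) contDiff_fst.contMDiff.contMDiffAt
      have h3 : ContMDiffAt 𝓘(ℝ, E × E) 𝓘(ℝ, E) ∞ (fun q : E × E ↦ e.symm (-q.2)) (p, x) :=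
        (hes (-x) hx).comp (p, x) (contDiff_snd.neg.contMDiff.contMDiffAt)
      exact χ.contMDiff.contMDiffAt.comp (p, x) (h2.inv.mul h3)
    · have h1 : Function.uncurry g =ᶠ[nhds (p, x)] fun _ ↦ (0 : ℝ) := by
        have hx' : (-(e '' K)ᶜ) ∈ nhds x :=
          (hKc.isClosed.isOpen_compl.neg).mem_nhds fun h ↦ hx (hKt h)
        filter_upwards [prod_mem_nhds (hWo.mem_nhds hp) hx'] with q hq
        have hq2 : -q.2 ∉ e '' K := hq.2
        simp only [Function.uncurry, hg]
        rw [indicator_of_notMem hq2]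
      exact contDiffAt_const.congr_of_eventuallyEq h1
  have hconv := contDiffOn_convolution_right_with_param_comp (n := ⊤) (ContinuousLinearMap.mul ℝ ℝ)
    (v := fun _ : E ↦ (0 : E)) contDiffOn_const hWo hKc.neg hg0 hφ'i hgs
  have hval : ∀ l ∈ e.source ∩ V, ∫ y, χ y * φ (l * y) ∂μ =
      convolution φ' (g (e l)) (ContinuousLinearMap.mul ℝ ℝ) ν 0 := by
    rintro l ⟨hl, hlV⟩
    rw [convolution_def]
    simp only [ContinuousLinearMap.mul_apply', hg, zero_sub, neg_neg, e.left_inv hl]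
    rw [hν, integral_map hme]
    · rw [← integral_mul_left_eq_self _ l⁻¹,
        ← setIntegral_eq_integral_of_forall_compl_eq_zero (s := K)]
      · refine setIntegral_congr_fun hK.measurableSet fun y hy ↦ ?_
        simp only [hφ']
        rw [indicator_of_mem (mem_image_of_mem e hy), indicator_of_mem (mem_image_of_mem e hy),
          mul_inv_cancel_left, Function.comp_apply, e.left_inv (hKe hy), mul_comm]
      · intro y hy
        rw [hχ0 l hlV y hy, zero_mul]
    · refine (hφ'i.aestronglyMeasurable).mul ?_
      have hc : Continuous fun x ↦ Function.uncurry g (e l, -x) := by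
        refine hgs.continuousOn.comp_continuous (by fun_prop) fun x ↦ ⟨⟨e.map_source hl, ?_⟩, trivial⟩
        simpa [e.left_inv hl] using hlV
      simpa [hg, Function.uncurry, e.left_inv hl] using hc.aestronglyMeasurable
  have hmem : e.source ∩ V ∈ nhds (1 : L) :=
    (e.open_source.inter hVo).mem_nhds ⟨h1e, h1V⟩
  have h1W : e 1 ∈ W := ⟨e.map_source h1e, by simpa [e.left_inv h1e] using h1V⟩
  have hfin : ContMDiffAt 𝓘(ℝ, E) 𝓘(ℝ, ℝ) ∞
      (fun l ↦ convolution φ' (g (e l)) (ContinuousLinearMap.mul ℝ ℝ) ν 0) 1 :=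
    ((hconv.contDiffAt (hWo.mem_nhds h1W)).contMDiffAt).comp (1 : L)
      (contMDiffOn_chart.contMDiffAt (e.open_source.mem_nhds h1e))
  exact hfin.congr_of_eventuallyEq (Filter.eventuallyEq_of_mem hmem hval)

end Smoothing

section Smoothing

open MeasureTheory Set

variable {E : Type*} [NormedAddCommGroup E] [NormedSpace ℝ E] [FiniteDimensional ℝ E]
  {L : Type*} [TopologicalSpace L] [ChartedSpace E L] [Group L] [LieGroup 𝓘(ℝ, E) ∞ L]

/-- A continuous cocycle for a continuous positive character of a Lie group is smooth, as is the
character; together they form a homomorphism to the affine group. -/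
theorem LieGroup.contMDiff_of_continuous_cocycle {c F : L → ℝ} (hc : Continuous c)
    (hF : Continuous F) (hpos : ∀ l, 0 < c l) (hcm : ∀ l m, c (l * m) = c l * c m)
    (hFm : ∀ l m, F (l * m) = c l * F m + F l) :
    ContMDiff 𝓘(ℝ, E) 𝓘(ℝ, ℝ) ∞ c ∧ ContMDiff 𝓘(ℝ, E) 𝓘(ℝ, ℝ) ∞ F := by
  have : IsTopologicalGroup L := topologicalGroup_of_lieGroup 𝓘(ℝ, E) ∞
  have : T1Space L := ChartedSpace.t1Space E L
  have : LocallyCompactSpace L := Manifold.locallyCompact_of_finiteDimensional 𝓘(ℝ, E)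
  borelize L
  obtain ⟨χ, hχ, hχK, hχ0, hχ1, hav⟩ :=
    LieGroup.exists_contMDiffAt_integral_mul (E := E) (Measure.haar : Measure L)
  have hint : ∀ {φ : L → ℝ}, Continuous φ →
      Integrable (fun y ↦ χ y * φ y) (Measure.haar : Measure L) := fun hφ ↦
    (hχ.mul hφ).integrable_of_hasCompactSupport hχK.mul_right
  set A : ℝ := ∫ y, χ y * c y ∂Measure.haar with hA
  set B : ℝ := ∫ y, χ y * F y ∂Measure.haar with hB
  set D : ℝ := ∫ y, χ y ∂Measure.haar with hD
  have hApos : 0 < A := by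
    refine (hχ.mul hc).integral_pos_of_hasCompactSupport_nonneg_nonzero (x := 1) hχK.mul_right
      (fun y ↦ mul_nonneg (hχ0 y) (hpos y).le) ?_
    rw [hχ1, one_mul]
    exact (hpos 1).ne'
  have hDpos : 0 < D :=
    hχ.integral_pos_of_hasCompactSupport_nonneg_nonzero (x := 1) hχK hχ0 (by simp [hχ1])
  have hcA : ∀ l, ∫ y, χ y * c (l * y) ∂Measure.haar = c l * A := by
    intro l
    rw [hA, ← integral_const_mul]
    congr 1
    ext y
    rw [hcm]
    ring
  have hFB : ∀ l, ∫ y, χ y * F (l * y) ∂Measure.haar = c l * B + F l * D := by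
    intro l
    rw [hB, hD, ← integral_const_mul, ← integral_const_mul, ← integral_add]
    · congr 1
      ext y
      rw [hFm]
      ring
    · exact (hint hF).const_mul _
    · exact (hχ.integrable_of_hasCompactSupport hχK).const_mul _
  have hc1 : ContMDiffAt 𝓘(ℝ, E) 𝓘(ℝ, ℝ) ∞ c 1 := by
    have h1 := (hav c hc).mul (contMDiffAt_const (c := A⁻¹))
    refine h1.congr_of_eventuallyEq (Filter.Eventually.of_forall fun l ↦ ?_)
    change c l = (∫ y, χ y * c (l * y) ∂Measure.haar) * A⁻¹
    rw [hcA, mul_inv_cancel_right₀ hApos.ne']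
  have hF1 : ContMDiffAt 𝓘(ℝ, E) 𝓘(ℝ, ℝ) ∞ F 1 := by
    have h1 := ((hav F hF).sub (hc1.mul (contMDiffAt_const (c := B)))).mul
      (contMDiffAt_const (c := D⁻¹))
    refine h1.congr_of_eventuallyEq (Filter.Eventually.of_forall fun l ↦ ?_)
    change F l = (∫ y, χ y * F (l * y) ∂Measure.haar - c l * B) * D⁻¹
    rw [hFB, add_sub_cancel_left, mul_inv_cancel_right₀ hDpos.ne']
  have htr : ∀ (l₀ : L) {φ : L → ℝ}, ContMDiffAt 𝓘(ℝ, E) 𝓘(ℝ, ℝ) ∞ φ 1 →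
      ContMDiffAt 𝓘(ℝ, E) 𝓘(ℝ, ℝ) ∞ (fun l ↦ φ (l₀⁻¹ * l)) l₀ := fun l₀ φ hφ ↦
    ContMDiffAt.comp l₀ (by rwa [inv_mul_cancel]) contMDiffAt_mul_left
  constructor <;> intro l₀
  · have h1 := (contMDiffAt_const (c := c l₀)).mul (htr l₀ hc1)
    refine h1.congr_of_eventuallyEq (Filter.Eventually.of_forall fun l ↦ ?_)
    change c l = c l₀ * c (l₀⁻¹ * l)
    rw [← hcm, mul_inv_cancel_left]
  · have h1 := ((contMDiffAt_const (c := c l₀)).mul (htr l₀ hF1)).add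
      (contMDiffAt_const (c := F l₀))
    refine h1.congr_of_eventuallyEq (Filter.Eventually.of_forall fun l ↦ ?_)
    change F l = c l₀ * F (l₀⁻¹ * l) + F l₀
    rw [← hFm, mul_inv_cancel_left]

end Smoothing

/-! ### Lie brackets as commutators of derivations -/

section Bracket

open VectorField

variable {E : Type*} [NormedAddCommGroup E] [NormedSpace ℝ E] [FiniteDimensional ℝ E]
  {M : Type*} [TopologicalSpace M] [ChartedSpace E M] [IsManifold 𝓘(ℝ, E) ∞ M]

/-- Differentiation along a Lie bracket of vector fields on a manifold is the commutator of the
differentiations along the vector fields. -/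
theorem mvfderiv_apply_mlieBracket {F : M → ℝ} {x : M} {V W : Π y : M, TangentSpace 𝓘(ℝ, E) y}
    (hF : ContMDiff 𝓘(ℝ, E) 𝓘(ℝ, ℝ) ∞ F)
    (hV : MDifferentiableAt 𝓘(ℝ, E) 𝓘(ℝ, E).tangent (fun y ↦ (V y : TangentBundle 𝓘(ℝ, E) M)) x)
    (hW : MDifferentiableAt 𝓘(ℝ, E) 𝓘(ℝ, E).tangent (fun y ↦ (W y : TangentBundle 𝓘(ℝ, E) M)) x)
    (hdV : MDifferentiableAt 𝓘(ℝ, E) 𝓘(ℝ, ℝ) (fun y ↦ mvfderiv 𝓘(ℝ, E) F y (V y)) x)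
    (hdW : MDifferentiableAt 𝓘(ℝ, E) 𝓘(ℝ, ℝ) (fun y ↦ mvfderiv 𝓘(ℝ, E) F y (W y)) x) :
    mvfderiv 𝓘(ℝ, E) F x (mlieBracket 𝓘(ℝ, E) V W x) =
      mvfderiv 𝓘(ℝ, E) (fun y ↦ mvfderiv 𝓘(ℝ, E) F y (W y)) x (V x) -
        mvfderiv 𝓘(ℝ, E) (fun y ↦ mvfderiv 𝓘(ℝ, E) F y (V y)) x (W x) := by
  have : IsManifold 𝓘(ℝ, E) 1 M := .of_le (n := ∞) (by simp)
  set φ := extChartAt 𝓘(ℝ, E) x with hφ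
  -- `P U` is the vector field `U` in the chart
  obtain ⟨P, hP⟩ : ∃ P : (Π y : M, TangentSpace 𝓘(ℝ, E) y) → E → E, P = fun U ↦
      mpullbackWithin 𝓘(ℝ, E) 𝓘(ℝ, E) φ.symm U (Set.range 𝓘(ℝ, E)) := ⟨_, rfl⟩
  have hx : φ x ∈ φ.target := mem_extChartAt_target x
  have hxx : φ.symm (φ x) = x := extChartAt_to_inv x
  have hto : φ.target ∈ nhds (φ x) := extChartAt_target_mem_nhds x
  have hrange : Set.range (𝓘(ℝ, E) : E → E) = Set.univ := by simp
  have hsymm : ∀ y ∈ φ.target, MDifferentiableAt 𝓘(ℝ, E) 𝓘(ℝ, E) φ.symm y := by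
    intro y hy
    have := mdifferentiableWithinAt_extChartAt_symm (I := 𝓘(ℝ, E)) hy
    rwa [hrange, mdifferentiableWithinAt_univ] at this
  have hinv : ∀ y ∈ φ.target, (mfderiv 𝓘(ℝ, E) 𝓘(ℝ, E) φ.symm y).IsInvertible := by
    intro y hy
    have := isInvertible_mfderivWithin_extChartAt_symm (I := 𝓘(ℝ, E)) hy
    rwa [hrange, mfderivWithin_univ] at this
  -- the derivative of a function along `U`, computed in the chart
  have hcomp : ∀ (f : M → ℝ) (U : Π y : M, TangentSpace 𝓘(ℝ, E) y), ∀ y ∈ φ.target,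
      MDifferentiableAt 𝓘(ℝ, E) 𝓘(ℝ, ℝ) f (φ.symm y) →
      fderiv ℝ (f ∘ φ.symm) y (P U y) = mvfderiv 𝓘(ℝ, E) f (φ.symm y) (U (φ.symm y)) := by
    intro f U y hy hf
    have hPU : P U y = (mfderiv 𝓘(ℝ, E) 𝓘(ℝ, E) φ.symm y).inverse (U (φ.symm y)) := by
      rw [hP, ← mfderivWithin_univ, ← hrange]
      rfl
    rw [hPU, ← mfderiv_eq_fderiv, mfderiv_comp y hf (hsymm y hy)]
    change mfderiv 𝓘(ℝ, E) 𝓘(ℝ, ℝ) f (φ.symm y) (mfderiv 𝓘(ℝ, E) 𝓘(ℝ, E) φ.symm y _) = _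
    rw [(hinv y hy).self_apply_inverse]
    rfl
  have hcompx : ∀ (f : M → ℝ) (U : Π y : M, TangentSpace 𝓘(ℝ, E) y),
      MDifferentiableAt 𝓘(ℝ, E) 𝓘(ℝ, ℝ) f x →
      fderiv ℝ (f ∘ φ.symm) (φ x) (P U (φ x)) = mvfderiv 𝓘(ℝ, E) f x (U x) := by
    intro f U hf
    have h1 := hcomp f U (φ x) hx (by rwa [hxx])
    rwa [hxx] at h1
  have hFd : MDifferentiable 𝓘(ℝ, E) 𝓘(ℝ, ℝ) F := hF.mdifferentiable (by simp)
  have hF' : ContDiffAt ℝ 2 (F ∘ φ.symm) (φ x) := by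
    rw [← contMDiffAt_iff_contDiffAt]
    have h1 : ContMDiffAt 𝓘(ℝ, E) 𝓘(ℝ, E) ∞ φ.symm (φ x) :=
      (contMDiffOn_extChartAt_symm x).contMDiffAt hto
    exact ((hF _).comp (φ x) h1).of_le (by exact ENat.LEInfty.out)
  have hdiff : ∀ U : Π y : M, TangentSpace 𝓘(ℝ, E) y,
      MDifferentiableAt 𝓘(ℝ, E) 𝓘(ℝ, E).tangent (fun y ↦ (U y : TangentBundle 𝓘(ℝ, E) M)) x →
      DifferentiableAt ℝ (P U) (φ x) := by
    intro U hU
    have h1 : DifferentiableWithinAt ℝ (P U) (φ.symm ⁻¹' Set.univ ∩ Set.range 𝓘(ℝ, E)) (φ x) := by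
      subst hP
      exact
        (mdifferentiableWithinAt_univ.2 hU).differentiableWithinAt_mpullbackWithin_vectorField
    rwa [Set.preimage_univ, Set.univ_inter, hrange, differentiableWithinAt_univ] at h1
  have key := fderiv_apply_lieBracket hF' (by simp) (hdiff W hW) (hdiff V hV)
  have hev : ∀ U : Π y : M, TangentSpace 𝓘(ℝ, E) y,
      (fun y ↦ fderiv ℝ (F ∘ φ.symm) y (P U y)) =ᶠ[nhds (φ x)]
      (fun y ↦ mvfderiv 𝓘(ℝ, E) F y (U y)) ∘ φ.symm := fun U ↦
    Filter.eventuallyEq_of_mem hto fun y hy ↦ hcomp F U y hy (hFd _)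
  rw [(hev W).fderiv_eq, (hev V).fderiv_eq, hcompx _ V hdW, hcompx _ W hdV] at key
  have hbr : mlieBracket 𝓘(ℝ, E) V W x = (mfderiv 𝓘(ℝ, E) 𝓘(ℝ, E) φ x).inverse
      (lieBracketWithin (E := E) ℝ (P V) (P W) (φ.symm ⁻¹' Set.univ ∩ Set.range 𝓘(ℝ, E)) (φ x)) := by
    subst hP
    exact mlieBracketWithin_apply
  rw [Set.preimage_univ, Set.univ_inter, hrange, lieBracketWithin_univ] at hbr
  rw [← key, hbr]
  have hφd : MDifferentiableAt 𝓘(ℝ, E) 𝓘(ℝ, E) φ x :=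
    mdifferentiableAt_extChartAt (mem_chart_source E x)
  have hFeq : mfderiv 𝓘(ℝ, E) 𝓘(ℝ, ℝ) F x =
      mfderiv 𝓘(ℝ, E) 𝓘(ℝ, ℝ) ((F ∘ φ.symm) ∘ φ) x := by
    refine Filter.EventuallyEq.mfderiv_eq (Filter.eventuallyEq_of_mem
      (extChartAt_source_mem_nhds (I := 𝓘(ℝ, E)) x) fun y hy ↦ ?_)
    simp only [Function.comp_apply]
    rw [φ.left_inv hy]
  change mfderiv 𝓘(ℝ, E) 𝓘(ℝ, ℝ) F x _ = _
  rw [hFeq, mfderiv_comp x (I' := 𝓘(ℝ, E)) ((hFd _).comp (φ x) (hsymm _ hx)) hφd]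
  change mfderiv 𝓘(ℝ, E) 𝓘(ℝ, ℝ) (F ∘ φ.symm) (φ x) (mfderiv 𝓘(ℝ, E) 𝓘(ℝ, E) φ x _) = _
  refine (congrArg (mfderiv 𝓘(ℝ, E) 𝓘(ℝ, ℝ) (F ∘ φ.symm) (φ x))
    ((isInvertible_mfderiv_extChartAt (mem_extChartAt_source x)).self_apply_inverse _)).trans ?_
  rw [mfderiv_eq_fderiv]
  rfl

end Bracket

/-! ### The exponential map of a Lie group -/

namespace LieLine

section Exp

variable {n : ℕ} {L : Type*} [TopologicalSpace L] [ChartedSpace (EuclideanSpace ℝ (Fin n)) L]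
  [Group L]

theorem mulInvariantVectorField_one (v : GroupLieAlgebra (𝓡 n) L) :
    mulInvariantVectorField v (1 : L) = v := by
  unfold mulInvariantVectorField
  have h1 : ((1 : L) * · : L → L) = id := by
    ext x
    simp
  rw [h1, mfderiv_id]
  rfl

theorem IsExpOf.comp_mul {v : GroupLieAlgebra (𝓡 n) L} {γ : ℝ → L} (hγ : IsExpOf v γ) (r : ℝ) :
    IsExpOf (r • v) fun t ↦ γ (r * t) := by
  have hγc := hγ.isOneParameterGroup.continuous
  refine ⟨⟨by fun_prop, fun s t ↦ by rw [mul_add, hγ.isOneParameterGroup.map_add]⟩, ?_⟩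
  have h1 : HasMFDerivAt 𝓘(ℝ, ℝ) 𝓘(ℝ, ℝ) (fun t : ℝ ↦ r * t) 0
      (ContinuousLinearMap.toSpanSingleton ℝ r) :=
    ((hasDerivAt_id (0 : ℝ)).const_mul r).hasFDerivAt.hasMFDerivAt.congr_mfderiv (by simp; rfl)
  have h2 : HasMFDerivAt 𝓘(ℝ, ℝ) (𝓡 n) γ (r * 0)
    (ContinuousLinearMap.toSpanSingleton ℝ (v : EuclideanSpace ℝ (Fin n))) := by
    rw [mul_zero]
    exact hγ.hasMFDerivAt
  refine (h2.comp (0 : ℝ) h1).congr_mfderiv ?_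
  ext
  change ((1 : ℝ) • r) • (v : EuclideanSpace ℝ (Fin n)) = (1 : ℝ) • r • v
  rw [one_smul, one_smul]

variable [LieGroup (𝓡 n) ∞ L]

theorem mulInvariantVectorField_mul (v : GroupLieAlgebra (𝓡 n) L) (l g : L) :
    mulInvariantVectorField v (l * g) =
      mfderiv (𝓡 n) (𝓡 n) (l * ·) g (mulInvariantVectorField v g) := by
  have hd : ∀ a b : L, MDifferentiableAt (𝓡 n) (𝓡 n) (a * ·) b := fun a b ↦
    (contMDiff_mul_left (I := 𝓡 n) (n := ∞)).mdifferentiableAt (by simp)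
  have h1 : ((l * g) * · : L → L) = (l * ·) ∘ (g * ·) := by
    ext x
    simp [mul_assoc]
  have h2 : MDifferentiableAt (𝓡 n) (𝓡 n) (l * ·) (g * 1) := hd _ _
  unfold mulInvariantVectorField
  rw [h1, mfderiv_comp (I' := 𝓡 n) (1 : L) h2 (hd g 1)]
  exact congrArg (fun z ↦ (mfderiv (𝓡 n) (𝓡 n) (l * ·) z :
      EuclideanSpace ℝ (Fin n) →L[ℝ] EuclideanSpace ℝ (Fin n))
    (mfderiv (𝓡 n) (𝓡 n) (g * ·) 1 v)) (mul_one g)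

theorem hasMFDerivAt_mul_left_comp {v : GroupLieAlgebra (𝓡 n) L} {γ : ℝ → L} {t : ℝ}
    (hγ : HasMFDerivAt 𝓘(ℝ, ℝ) (𝓡 n) γ t
      ((1 : ℝ →L[ℝ] ℝ).smulRight (mulInvariantVectorField v (γ t)))) (l : L) :
    HasMFDerivAt 𝓘(ℝ, ℝ) (𝓡 n) (fun t ↦ l * γ t) t
      ((1 : ℝ →L[ℝ] ℝ).smulRight (mulInvariantVectorField v (l * γ t))) := by
  have hd : MDifferentiableAt (𝓡 n) (𝓡 n) (l * ·) (γ t) :=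
    (contMDiff_mul_left (I := 𝓡 n) (n := ∞)).mdifferentiableAt (by simp)
  have h1 := hd.hasMFDerivAt.comp t hγ
  refine h1.congr_mfderiv ?_
  rw [mulInvariantVectorField_mul]
  ext
  exact map_smul (mfderiv (𝓡 n) (𝓡 n) (l * ·) (γ t) :
    EuclideanSpace ℝ (Fin n) →L[ℝ] EuclideanSpace ℝ (Fin n)) (1 : ℝ) _

/-- Left-invariant vector fields are complete, and their integral curves through `1` are
one-parameter groups. -/
theorem exists_isExpOf (v : GroupLieAlgebra (𝓡 n) L) : ∃ γ : ℝ → L, IsExpOf v γ := by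
  have : IsTopologicalGroup L := topologicalGroup_of_lieGroup (𝓡 n) ∞
  have : T1Space L := ChartedSpace.t1Space (EuclideanSpace ℝ (Fin n)) L
  have : IsManifold (𝓡 n) 1 L := .of_le (n := ∞) (by simp)
  have hX : ContMDiff (𝓡 n) (𝓡 n).tangent 1
      (fun g : L ↦ (mulInvariantVectorField v g : TangentBundle (𝓡 n) L)) :=
    (contMDiff_mulInvariantVectorField v).of_le (by
      rw [minSmoothness_of_isRCLikeNormedField]
      exact one_le_two)
  obtain ⟨γ₀, hγ₀, hγ₀X⟩ := exists_isMIntegralCurveAt_of_contMDiffAt_boundaryless (t₀ := 0)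
    (hX.contMDiffAt (x := 1))
  rw [isMIntegralCurveAt_iff'] at hγ₀X
  obtain ⟨ε, hε, hγ₀X⟩ := hγ₀X
  rw [Real.ball_eq_Ioo, zero_sub, zero_add] at hγ₀X
  obtain ⟨γ, hγ1, hγX⟩ := exists_isMIntegralCurve_of_isMIntegralCurveOn hX hε (fun l ↦
    ⟨fun t ↦ l * γ₀ t, by simp [hγ₀], fun t ht ↦
      (hasMFDerivAt_mul_left_comp ((hγ₀X t ht).hasMFDerivAt (isOpen_Ioo.mem_nhds ht))
        l).hasMFDerivWithinAt⟩) (1 : L)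
  have hmul : ∀ s t, γ (s + t) = γ s * γ t := by
    intro s t
    have h1 : IsMIntegralCurve (γ ∘ (· + s)) (mulInvariantVectorField v : Π g : L, _) :=
      hγX.comp_add s
    have h2 : IsMIntegralCurve (fun t ↦ γ s * γ t) (mulInvariantVectorField v : Π g : L, _) :=
      fun t ↦ hasMFDerivAt_mul_left_comp (hγX t) _
    have h3 := isMIntegralCurve_Ioo_eq_of_contMDiff_boundaryless (t₀ := 0) hX h1 h2
      (by simp [hγ1])
    simpa [add_comm] using congrFun h3 t
  refine ⟨γ, ⟨?_, hmul⟩, ?_⟩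
  · exact continuous_iff_continuousAt.2 fun t ↦ (hγX t).continuousAt
  · have h1 := hγX 0
    rw [hγ1, mulInvariantVectorField_one] at h1
    exact h1.congr_mfderiv rfl

end Exp
end LieLine

/-! ### Differentials of the slope and of the coordinate -/

namespace LieLine

section Derivative

variable {n : ℕ} {L : Type*} [TopologicalSpace L] [ChartedSpace (EuclideanSpace ℝ (Fin n)) L]
  [Group L]

theorem IsExpOf.hasDerivAt_comp {v : GroupLieAlgebra (𝓡 n) L} {γ : ℝ → L} (hγ : IsExpOf v γ)
    {φ : L → ℝ} (hφ : MDifferentiableAt (𝓡 n) 𝓘(ℝ, ℝ) φ 1) :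
    HasDerivAt (φ ∘ γ) (mvfderiv (𝓡 n) φ (1 : L) v) 0 := by
  have h0 := hγ.isOneParameterGroup.map_zero
  have h1 : HasMFDerivAt (𝓡 n) 𝓘(ℝ, ℝ) φ (γ 0) (mfderiv (𝓡 n) 𝓘(ℝ, ℝ) φ 1) := by
    rw [h0]
    exact hφ.hasMFDerivAt
  have h2 : HasFDerivAt (φ ∘ γ) ((mvfderiv (𝓡 n) φ (1 : L) : EuclideanSpace ℝ (Fin n) →L[ℝ] ℝ).comp
      (ContinuousLinearMap.toSpanSingleton ℝ (v : EuclideanSpace ℝ (Fin n)))) 0 :=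
    (h1.comp (0 : ℝ) hγ.hasMFDerivAt).hasFDerivAt
  refine h2.hasDerivAt.congr_deriv ?_
  change mvfderiv (𝓡 n) φ (1 : L) ((1 : ℝ) • v) = _
  rw [one_smul]

variable {G : Subgroup L}

namespace IsAffineCoordinate

variable {f : L ⧸ G ≃ₜ ℝ} {c F : L → ℝ}

/-- A one-parameter group lies in `G` exactly if its velocity is annihilated by the differential of
the coordinate. -/
theorem mvfderiv_intercept_eq_zero_iff (hf : IsAffineCoordinate f c F)
    (hF : MDifferentiableAt (𝓡 n) 𝓘(ℝ, ℝ) F 1) {v : GroupLieAlgebra (𝓡 n) L} {γ : ℝ → L}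
    (hγ : IsExpOf v γ) : mvfderiv (𝓡 n) F (1 : L) v = 0 ↔ ∀ t, F (γ t) = 0 := by
  have h0 := hγ.hasDerivAt_comp hF
  have hγ0 := hγ.isOneParameterGroup.map_zero
  constructor
  · intro hv
    have hs : ∀ s, HasDerivAt (F ∘ γ) 0 s := by
      intro s
      rw [hv] at h0
      have h1 : HasDerivAt (fun t ↦ c (γ s) * (F ∘ γ) (t - s) + F (γ s)) (c (γ s) * 0) s := by
        refine (HasDerivAt.const_mul _ ?_).add_const _
        exact HasDerivAt.comp_sub_const s s (by rwa [sub_self])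
      rw [mul_zero] at h1
      refine h1.congr_of_eventuallyEq (Filter.Eventually.of_forall fun t ↦ ?_)
      change F (γ t) = c (γ s) * F (γ (t - s)) + F (γ s)
      rw [← hf.intercept_mul, ← hγ.isOneParameterGroup.map_add, add_sub_cancel]
    intro t
    have h2 := is_const_of_deriv_eq_zero (fun s ↦ (hs s).differentiableAt)
      (fun s ↦ (hs s).deriv) t 0
    simpa [hγ0, hf.intercept_one] using h2
  · intro h
    have h1 : F ∘ γ = fun _ ↦ 0 := funext h
    rw [h1] at h0
    exact h0.unique (hasDerivAt_const _ _)

theorem mvfderiv_slope_eq_zero_iff (hf : IsAffineCoordinate f c F)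
    (hc : MDifferentiableAt (𝓡 n) 𝓘(ℝ, ℝ) c 1) {v : GroupLieAlgebra (𝓡 n) L} {γ : ℝ → L}
    (hγ : IsExpOf v γ) : mvfderiv (𝓡 n) c (1 : L) v = 0 ↔ ∀ t, c (γ t) = 1 := by
  have h0 := hγ.hasDerivAt_comp hc
  have hγ0 := hγ.isOneParameterGroup.map_zero
  constructor
  · intro hv
    have hs : ∀ s, HasDerivAt (c ∘ γ) 0 s := by
      intro s
      rw [hv] at h0
      have h1 : HasDerivAt (fun t ↦ c (γ s) * (c ∘ γ) (t - s)) (c (γ s) * 0) s := by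
        refine HasDerivAt.const_mul _ ?_
        exact HasDerivAt.comp_sub_const s s (by rwa [sub_self])
      rw [mul_zero] at h1
      refine h1.congr_of_eventuallyEq (Filter.Eventually.of_forall fun t ↦ ?_)
      change c (γ t) = c (γ s) * c (γ (t - s))
      rw [← hf.slope_mul, ← hγ.isOneParameterGroup.map_add, add_sub_cancel]
    intro t
    have h2 := is_const_of_deriv_eq_zero (fun s ↦ (hs s).differentiableAt)
      (fun s ↦ (hs s).deriv) t 0
    simpa [hγ0, hf.slope_one] using h2
  · intro h
    have h1 : c ∘ γ = fun _ ↦ 1 := funext h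
    rw [h1] at h0
    exact h0.unique (hasDerivAt_const _ _)

variable [LieGroup (𝓡 n) ∞ L]

theorem mvfderiv_comp_mul_left {φ : L → ℝ} (hφ : MDifferentiable (𝓡 n) 𝓘(ℝ, ℝ) φ) (l : L)
    (v : GroupLieAlgebra (𝓡 n) L) :
    mvfderiv (𝓡 n) φ l (mulInvariantVectorField v l) =
      mvfderiv (𝓡 n) (fun x ↦ φ (l * x)) (1 : L) v := by
  have hd : MDifferentiableAt (𝓡 n) (𝓡 n) (l * ·) (1 : L) :=
    (contMDiff_mul_left (I := 𝓡 n) (n := ∞)).mdifferentiableAt (by simp)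
  have h1 := mvfderiv_comp_apply (1 : L) (hφ (l * 1)) hd v
  refine Eq.trans ?_ h1.symm
  exact congrArg (fun z ↦ (mvfderiv (𝓡 n) φ z : EuclideanSpace ℝ (Fin n) →L[ℝ] ℝ)
    (mulInvariantVectorField v l)) (mul_one l).symm

theorem mvfderiv_intercept_mulInvariantVectorField (hf : IsAffineCoordinate f c F)
    (hF : MDifferentiable (𝓡 n) 𝓘(ℝ, ℝ) F) (l : L) (v : GroupLieAlgebra (𝓡 n) L) :
    mvfderiv (𝓡 n) F l (mulInvariantVectorField v l) = c l * mvfderiv (𝓡 n) F (1 : L) v := by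
  rw [mvfderiv_comp_mul_left hF]
  have h1 : (fun x ↦ F (l * x)) = (fun _ ↦ c l) * F + fun _ ↦ F l := by
    ext x
    exact hf.intercept_mul l x
  rw [h1, mvfderiv_add ((mdifferentiableAt_const).mul (hF 1)) mdifferentiableAt_const,
    mvfderiv_mul mdifferentiableAt_const (hF 1), mvfderiv_const, mvfderiv_const]
  simp

/-- The differential of the coordinate on brackets: it is the bracket in the Lie algebra of the
affine group. -/
theorem mvfderiv_intercept_bracket (hf : IsAffineCoordinate f c F)
    (hc : ContMDiff (𝓡 n) 𝓘(ℝ, ℝ) ∞ c) (hF : ContMDiff (𝓡 n) 𝓘(ℝ, ℝ) ∞ F)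
    (u v : GroupLieAlgebra (𝓡 n) L) :
    mvfderiv (𝓡 n) F (1 : L) ⁅u, v⁆ =
      mvfderiv (𝓡 n) c (1 : L) u * mvfderiv (𝓡 n) F (1 : L) v -
        mvfderiv (𝓡 n) c (1 : L) v * mvfderiv (𝓡 n) F (1 : L) u := by
  have hcd : MDifferentiable (𝓡 n) 𝓘(ℝ, ℝ) c := hc.mdifferentiable (by simp)
  have hFd : MDifferentiable (𝓡 n) 𝓘(ℝ, ℝ) F := hF.mdifferentiable (by simp)
  have hfield : ∀ w : GroupLieAlgebra (𝓡 n) L,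
      (fun l ↦ mvfderiv (𝓡 n) F l (mulInvariantVectorField w l)) =
        c * fun _ ↦ mvfderiv (𝓡 n) F (1 : L) w := fun w ↦
    funext fun l ↦ hf.mvfderiv_intercept_mulInvariantVectorField hFd l w
  have hd : ∀ w : GroupLieAlgebra (𝓡 n) L, MDifferentiableAt (𝓡 n) 𝓘(ℝ, ℝ)
      (fun l ↦ mvfderiv (𝓡 n) F l (mulInvariantVectorField w l)) 1 := fun w ↦ by
    rw [hfield]
    exact (hcd 1).mul mdifferentiableAt_const
  rw [GroupLieAlgebra.bracket_def, mvfderiv_apply_mlieBracket hF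
    (mdifferentiableAt_mulInvariantVectorField u) (mdifferentiableAt_mulInvariantVectorField v)
    (hd u) (hd v), hfield, hfield, mulInvariantVectorField_one, mulInvariantVectorField_one,
    mvfderiv_mul (hcd 1) mdifferentiableAt_const, mvfderiv_mul (hcd 1) mdifferentiableAt_const,
    mvfderiv_const, mvfderiv_const]
  simp [mul_comm]

theorem mvfderiv_Ad {φ : L → ℝ} (hφ : MDifferentiable (𝓡 n) 𝓘(ℝ, ℝ) φ) (l : L)
    (v : GroupLieAlgebra (𝓡 n) L) :
    mvfderiv (𝓡 n) φ (1 : L) (Ad n l v : EuclideanSpace ℝ (Fin n)) =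
      mvfderiv (𝓡 n) (fun x ↦ φ (l * x * l⁻¹)) (1 : L) v := by
  have hd : MDifferentiableAt (𝓡 n) (𝓡 n) (fun x ↦ l * x * l⁻¹) (1 : L) :=
    ((contMDiff_mul_right (I := 𝓡 n) (n := ∞)).comp
      (contMDiff_mul_left (I := 𝓡 n) (n := ∞))).mdifferentiableAt (by simp)
  have h1 := mvfderiv_comp_apply (1 : L) (hφ (l * 1 * l⁻¹)) hd v
  refine Eq.trans ?_ h1.symm
  exact congrArg (fun z ↦ (mvfderiv (𝓡 n) φ z : EuclideanSpace ℝ (Fin n) →L[ℝ] ℝ)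
    (Ad n l v)) (by simp : (1 : L) = l * 1 * l⁻¹)

/-- If the slope of `l` is not one then some combination of the differentials of the coordinate and
of the slope, nonzero on the velocities of translations, is an eigenvector of the transpose of
`Ad l` with the slope as eigenvalue. -/
theorem exists_eigenform (hf : IsAffineCoordinate f c F)
    (hc : ContMDiff (𝓡 n) 𝓘(ℝ, ℝ) ∞ c) (hF : ContMDiff (𝓡 n) 𝓘(ℝ, ℝ) ∞ F)
    {w : EuclideanSpace ℝ (Fin n)} (hcw : mvfderiv (𝓡 n) c (1 : L) w = 0)
    (hFw : mvfderiv (𝓡 n) F (1 : L) w ≠ 0) {l : L} (hl : c l ≠ 1) :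
    ∃ ℓ : EuclideanSpace ℝ (Fin n) →ₗ[ℝ] ℝ, ℓ w ≠ 0 ∧ ∀ v, ℓ (Ad n l v) = c l * ℓ v := by
  have hcd : MDifferentiable (𝓡 n) 𝓘(ℝ, ℝ) c := hc.mdifferentiable (by simp)
  have hFd : MDifferentiable (𝓡 n) 𝓘(ℝ, ℝ) F := hF.mdifferentiable (by simp)
  obtain ⟨α, hα⟩ : ∃ α : EuclideanSpace ℝ (Fin n) →L[ℝ] ℝ, α = mvfderiv (𝓡 n) c (1 : L) :=
    ⟨_, rfl⟩
  obtain ⟨β, hβ⟩ : ∃ β : EuclideanSpace ℝ (Fin n) →L[ℝ] ℝ, β = mvfderiv (𝓡 n) F (1 : L) :=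
    ⟨_, rfl⟩
  have hαAd : ∀ v, α (Ad n l v) = α v := by
    intro v
    rw [hα]
    refine (mvfderiv_Ad hcd l v).trans ?_
    have h1 : (fun x ↦ c (l * x * l⁻¹)) = c := by
      ext x
      rw [hf.slope_mul, hf.slope_mul, mul_comm (c l), mul_assoc, ← hf.slope_mul, mul_inv_cancel,
        hf.slope_one, mul_one]
    rw [h1]
    rfl
  have hβAd : ∀ v, β (Ad n l v) = c l * (β v + F l⁻¹ * α v) := by
    intro v
    rw [hβ, hα]
    refine (mvfderiv_Ad hFd l v).trans ?_
    have h1 : (fun x ↦ F (l * x * l⁻¹)) =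
        (fun _ ↦ c l) * (F + (fun _ ↦ F l⁻¹) * c) + fun _ ↦ F l := by
      ext x
      simp only [mul_assoc l, hf.intercept_mul, Pi.add_apply, Pi.mul_apply]
      ring
    have h2 : MDifferentiableAt (𝓡 n) 𝓘(ℝ, ℝ) ((fun _ ↦ F l⁻¹) * c) (1 : L) :=
      mdifferentiableAt_const.mul (hcd 1)
    rw [h1, mvfderiv_add (mdifferentiableAt_const.mul ((hFd 1).add h2)) mdifferentiableAt_const,
      mvfderiv_mul mdifferentiableAt_const ((hFd 1).add h2), mvfderiv_add (hFd 1) h2,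
      mvfderiv_mul mdifferentiableAt_const (hcd 1), mvfderiv_const, mvfderiv_const, mvfderiv_const]
    simp only [smul_zero, add_zero]
    rfl
  -- the coefficient of `α` is chosen to make `β + s • α` an eigenvector
  refine ⟨(β + (c l * F l⁻¹ / (c l - 1)) • α : EuclideanSpace ℝ (Fin n) →L[ℝ] ℝ), ?_, fun v ↦ ?_⟩
  · have h1 : α w = 0 := by rw [hα]; exact hcw
    have h2 : β w ≠ 0 := by rw [hβ]; exact hFw
    simpa [h1] using h2
  · have h3 : c l - 1 ≠ 0 := sub_ne_zero.2 hl
    simp only [ContinuousLinearMap.coe_coe, add_apply, smul_apply,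
      smul_eq_mul, hαAd, hβAd]
    field_simp
    ring

end IsAffineCoordinate

end Derivative

section Eigenform

variable {V : Type*} [AddCommGroup V] [Module ℝ V]

theorem eq_one_of_isNilpotent_sub_one {T : Module.End ℝ V} (hT : IsNilpotent (T - 1))
    {ℓ : V →ₗ[ℝ] ℝ} {w : V} (hw : ℓ w ≠ 0) {a : ℝ} (hℓ : ∀ v, ℓ (T v) = a * ℓ v) : a = 1 := by
  obtain ⟨k, hk⟩ := hT
  have h1 : ∀ j, ℓ (((T - 1) ^ j) w) = (a - 1) ^ j * ℓ w := by
    intro j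
    induction j with
    | zero => simp
    | succ j ih =>
      rw [pow_succ', Module.End.mul_apply, LinearMap.sub_apply, map_sub, hℓ, Module.End.one_apply,
        ih]
      ring
  have h2 := h1 k
  rw [hk, LinearMap.zero_apply, map_zero, eq_comm, mul_eq_zero, or_iff_left hw] at h2
  exact sub_eq_zero.1 (eq_zero_of_pow_eq_zero h2)

/-- An eigenvalue of the transpose, witnessed by a nonzero eigenform, is a root of the characteristic
polynomial. -/
theorem isRoot_charpoly_of_eigenform [FiniteDimensional ℝ V] {T : Module.End ℝ V} {ℓ : V →ₗ[ℝ] ℝ}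
    {w : V} (hw : ℓ w ≠ 0) {a : ℝ} (hℓ : ∀ v, ℓ (T v) = a * ℓ v) : T.charpoly.IsRoot a := by
  rw [← Module.End.mem_spectrum_iff_isRoot_charpoly, spectrum.mem_iff]
  rintro ⟨u, hu⟩
  have h1 : ∀ v, ℓ ((u : Module.End ℝ V) v) = 0 := by
    intro v
    rw [hu, LinearMap.sub_apply, map_sub, hℓ, Module.algebraMap_end_apply, map_smul, smul_eq_mul,
      sub_self]
  refine hw ?_
  have h2 := h1 (((u⁻¹ : (Module.End ℝ V)ˣ) : Module.End ℝ V) w)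
  rwa [← Module.End.mul_apply, Units.mul_inv, Module.End.one_apply] at h2

end Eigenform

end LieLine

/-! ### The homomorphism to the affine group and the Lie algebras of its kernels -/

/-- The increasing affine map `x ↦ a * x + b`. -/
noncomputable def AffPlus.ofSlopeIntercept (a b : ℝ) (ha : 0 < a) : AffPlus :=
  ⟨{ toEquiv :=
      { toFun := fun x ↦ a * x + b
        invFun := fun x ↦ a⁻¹ * (x - b)
        left_inv := fun x ↦ by field_simp; ring
        right_inv := fun x ↦ by field_simp; ring }
     linear := LinearEquiv.smulOfNeZero ℝ ℝ a ha.ne'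
     map_vadd' := fun p v ↦ by
      simp only [Equiv.coe_fn_mk, vadd_eq_add, LinearEquiv.smulOfNeZero_apply, smul_eq_mul]
      ring }, by
    show 0 < LinearEquiv.smulOfNeZero ℝ ℝ a ha.ne' 1
    simpa using ha⟩

theorem AffPlus.ofSlopeIntercept_apply (a b : ℝ) (ha : 0 < a) (x : ℝ) :
    (AffPlus.ofSlopeIntercept a b ha : ℝ ≃ᵃ[ℝ] ℝ) x = a * x + b := rfl

theorem AffPlus.slope_ofSlopeIntercept (a b : ℝ) (ha : 0 < a) :
    AffPlus.slope (AffPlus.ofSlopeIntercept a b ha) = a := by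
  show LinearEquiv.smulOfNeZero ℝ ℝ a ha.ne' 1 = a
  simp

theorem AffPlus.intercept_ofSlopeIntercept (a b : ℝ) (ha : 0 < a) :
    AffPlus.intercept (AffPlus.ofSlopeIntercept a b ha) = b := by
  show a * 0 + b = b
  simp

theorem AffPlus.ofSlopeIntercept_mem_translations (a b : ℝ) (ha : 0 < a) :
    AffPlus.ofSlopeIntercept a b ha ∈ AffPlus.translations ↔ a = 1 := by
  rw [AffPlus.translations, Subgroup.mem_subgroupOf, MonoidHom.mem_range]
  constructor
  · rintro ⟨v, hv⟩
    have h0 := congrArg (fun e : ℝ ≃ᵃ[ℝ] ℝ ↦ e 0) hv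
    have h1 := congrArg (fun e : ℝ ≃ᵃ[ℝ] ℝ ↦ e 1) hv
    simp only [AffPlus.ofSlopeIntercept_apply, AffineEquiv.constVAddHom_apply,
      AffineEquiv.constVAdd_apply, vadd_eq_add] at h0 h1
    linarith
  · rintro rfl
    refine ⟨Multiplicative.ofAdd b, AffineEquiv.ext fun x ↦ ?_⟩
    simp only [AffPlus.ofSlopeIntercept_apply, AffineEquiv.constVAddHom_apply,
      AffineEquiv.constVAdd_apply, vadd_eq_add, toAdd_ofAdd]
    ring

theorem QuotientGroup.mem_normalCore_iff_forall_smul_eq {L : Type*} [Group L] (G : Subgroup L)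
    (l : L) : l ∈ G.normalCore ↔ ∀ x : L ⧸ G, l • x = x := by
  have h1 : ∀ b : L, l • (b : L ⧸ G) = b ↔ b⁻¹ * l * b ∈ G := fun b ↦ by
    rw [MulAction.Quotient.smul_coe, eq_comm, QuotientGroup.eq, smul_eq_mul, mul_assoc]
  constructor
  · intro hl x
    obtain ⟨b, rfl⟩ := QuotientGroup.mk_surjective x
    exact (h1 b).2 (by simpa using hl b⁻¹)
  · intro h b
    simpa using (h1 b⁻¹).1 (h _)

namespace LieLine

section Affine

variable {L : Type*} [TopologicalSpace L] [Group L] {G : Subgroup L}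

namespace IsAffineCoordinate

variable {f : L ⧸ G ≃ₜ ℝ} {c F : L → ℝ}

/-- The homomorphism to the affine group given by an affine coordinate. -/
noncomputable def toAffPlus (hf : IsAffineCoordinate f c F) : L →* AffPlus where
  toFun l := AffPlus.ofSlopeIntercept (c l) (F l) (hf.slope_pos l)
  map_one' := by
    refine Subtype.ext (AffineEquiv.ext fun x ↦ ?_)
    rw [AffPlus.ofSlopeIntercept_apply, hf.slope_one, hf.intercept_one, one_mul, add_zero]
    rfl
  map_mul' l m := by
    refine Subtype.ext (AffineEquiv.ext fun x ↦ ?_)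
    rw [AffPlus.ofSlopeIntercept_apply, hf.slope_mul, hf.intercept_mul]
    change _ = c l * (c m * x + F m) + F l
    ring

theorem mem_comap_translations (hf : IsAffineCoordinate f c F) (l : L) :
    l ∈ AffPlus.translations.comap hf.toAffPlus ↔ c l = 1 :=
  AffPlus.ofSlopeIntercept_mem_translations _ _ (hf.slope_pos l)

theorem mem_normalCore_iff (hf : IsAffineCoordinate f c F) (l : L) :
    l ∈ G.normalCore ↔ c l = 1 ∧ F l = 0 := by
  rw [QuotientGroup.mem_normalCore_iff_forall_smul_eq, hf.smul_eq_self_iff]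

/-- An affine one-parameter group containing a non-translation has a fixed point, namely that of
the non-translation. -/
theorem slope_eq_one_of_actsTransitively (hf : IsAffineCoordinate f c F) {γ : ℝ → L}
    (hγ : IsOneParameterGroup γ) (h : ActsTransitively G γ) (t : ℝ) : c (γ t) = 1 := by
  by_contra hne
  have h1 : 1 - c (γ t) ≠ 0 := sub_ne_zero.2 (Ne.symm hne)
  have huniq : ∀ x : L ⧸ G, γ t • x = x → f x = F (γ t) / (1 - c (γ t)) := by
    intro x hx
    have h2 := hf.apply_smul (γ t) x
    rw [hx] at h2
    rw [eq_div_iff h1]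
    linarith
  set x := f.symm (F (γ t) / (1 - c (γ t))) with hx
  have hfix : γ t • x = x := by
    apply f.injective
    rw [hf.apply_smul, hx, f.apply_symm_apply]
    field_simp
    ring
  obtain ⟨s, hs⟩ := h x (f.symm (f x + 1))
  have h3 := huniq (γ s • x) (by
    rw [← mul_smul, ← hγ.map_add, add_comm, hγ.map_add, mul_smul, hfix])
  rw [hs, f.apply_symm_apply, huniq x hfix] at h3
  linarith

theorem actsTransitively_or_actsTrivially_iff (hf : IsAffineCoordinate f c F) {γ : ℝ → L}
    (hγ : IsOneParameterGroup γ) :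
    (ActsTransitively G γ ∨ ActsTrivially G γ) ↔ ∀ t, c (γ t) = 1 := by
  constructor
  · rintro (h | h) t
    · exact hf.slope_eq_one_of_actsTransitively hγ h t
    · exact ((hf.smul_eq_self_iff _).1 (h t)).1
  · intro h
    have hadd : ∀ s t, F (γ (s + t)) = F (γ s) + F (γ t) := by
      intro s t
      rw [hγ.map_add, hf.intercept_mul, h, one_mul, add_comm]
    have hlin : ∀ t, F (γ t) = t * F (γ 1) := by
      intro t
      have h1 := map_real_smul (AddMonoidHom.mk' (fun t ↦ F (γ t)) hadd)
        (hf.continuous_intercept.comp hγ.continuous) t 1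
      simpa using h1
    by_cases hb : F (γ 1) = 0
    · refine Or.inr fun t ↦ (hf.smul_eq_self_iff _).2 ⟨h t, ?_⟩
      rw [hlin, hb, mul_zero]
    · refine Or.inl fun x y ↦ ⟨(f y - f x) / F (γ 1), f.injective ?_⟩
      rw [hf.apply_smul, h, hlin]
      field_simp
      ring

end IsAffineCoordinate

end Affine

section LieSubgroup

variable {n : ℕ} {L : Type*} [TopologicalSpace L] [ChartedSpace (EuclideanSpace ℝ (Fin n)) L]
  [Group L] [LieGroup (𝓡 n) ∞ L]

theorem IsConnectedLieSubgroup.exists_oneParameterGroups {N : Subgroup L}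
    (hN : IsConnectedLieSubgroup n N) : ∃ 𝒮 : Set (ℝ → L),
      (∀ γ ∈ 𝒮, ∃ v : GroupLieAlgebra (𝓡 n) L, IsExpOf v γ) ∧ (∀ γ ∈ 𝒮, ∀ t, γ t ∈ N) ∧
      N = Subgroup.closure {g | ∃ γ ∈ 𝒮, γ 1 = g} := by
  obtain ⟨𝔥, h𝔥⟩ := hN
  refine ⟨{γ | ∃ v ∈ 𝔥, IsExpOf v γ}, fun γ ⟨v, _, h⟩ ↦ ⟨v, h⟩, ?_, ?_⟩
  · rintro γ ⟨v, hv, hγ⟩ t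
    rw [h𝔥]
    exact Subgroup.subset_closure ⟨t • v, 𝔥.smul_mem t hv, _, hγ.comp_mul t, by rw [mul_one]⟩
  · rw [h𝔥]
    congr 1
    ext g
    constructor
    · rintro ⟨v, hv, γ, hγ, rfl⟩
      exact ⟨γ, ⟨v, hv, hγ⟩, rfl⟩
    · rintro ⟨γ, ⟨v, hv, hγ⟩, rfl⟩
      exact ⟨v, hv, γ, hγ, rfl⟩

namespace IsAffineCoordinate

variable {G : Subgroup L} {f : L ⧸ G ≃ₜ ℝ} {c F : L → ℝ}

theorem mem_lieAlg_iff (hf : IsAffineCoordinate f c F)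
    (hF : MDifferentiableAt (𝓡 n) 𝓘(ℝ, ℝ) F 1) (v : GroupLieAlgebra (𝓡 n) L) :
    v ∈ lieAlg n G ↔ mvfderiv (𝓡 n) F (1 : L) v = 0 := by
  constructor
  · rintro ⟨γ, hγ, hγG⟩
    exact (hf.mvfderiv_intercept_eq_zero_iff hF hγ).2 fun t ↦ (hf.mem_iff _).1 (hγG t)
  · intro hv
    obtain ⟨γ, hγ⟩ := exists_isExpOf v
    exact ⟨γ, hγ, fun t ↦ (hf.mem_iff _).2 ((hf.mvfderiv_intercept_eq_zero_iff hF hγ).1 hv t)⟩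

theorem mem_lieAlg_comap_translations_iff (hf : IsAffineCoordinate f c F)
    (hc : MDifferentiableAt (𝓡 n) 𝓘(ℝ, ℝ) c 1) (v : GroupLieAlgebra (𝓡 n) L) :
    v ∈ lieAlg n (AffPlus.translations.comap hf.toAffPlus) ↔ mvfderiv (𝓡 n) c (1 : L) v = 0 := by
  constructor
  · rintro ⟨γ, hγ, hγT⟩
    exact (hf.mvfderiv_slope_eq_zero_iff hc hγ).2 fun t ↦
      (hf.mem_comap_translations _).1 (hγT t)
  · intro hv
    obtain ⟨γ, hγ⟩ := exists_isExpOf v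
    exact ⟨γ, hγ, fun t ↦
      (hf.mem_comap_translations _).2 ((hf.mvfderiv_slope_eq_zero_iff hc hγ).1 hv t)⟩

theorem mem_lieAlg_normalCore_iff (hf : IsAffineCoordinate f c F)
    (hc : MDifferentiableAt (𝓡 n) 𝓘(ℝ, ℝ) c 1) (hF : MDifferentiableAt (𝓡 n) 𝓘(ℝ, ℝ) F 1)
    (v : GroupLieAlgebra (𝓡 n) L) :
    v ∈ lieAlg n G.normalCore ↔
      mvfderiv (𝓡 n) c (1 : L) v = 0 ∧ mvfderiv (𝓡 n) F (1 : L) v = 0 := by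
  constructor
  · rintro ⟨γ, hγ, hγG⟩
    exact ⟨(hf.mvfderiv_slope_eq_zero_iff hc hγ).2 fun t ↦ ((hf.mem_normalCore_iff _).1 (hγG t)).1,
      (hf.mvfderiv_intercept_eq_zero_iff hF hγ).2 fun t ↦
        ((hf.mem_normalCore_iff _).1 (hγG t)).2⟩
  · rintro ⟨hv, hv'⟩
    obtain ⟨γ, hγ⟩ := exists_isExpOf v
    exact ⟨γ, hγ, fun t ↦ (hf.mem_normalCore_iff _).2
      ⟨(hf.mvfderiv_slope_eq_zero_iff hc hγ).1 hv t,
        (hf.mvfderiv_intercept_eq_zero_iff hF hγ).1 hv' t⟩⟩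

theorem isQuotientDiffeo (hf : IsAffineCoordinate f c F) (hF : ContMDiff (𝓡 n) 𝓘(ℝ, ℝ) ∞ F)
    {w : GroupLieAlgebra (𝓡 n) L} (hw : mvfderiv (𝓡 n) F (1 : L) w ≠ 0) :
    IsQuotientDiffeo n f := by
  have h1 : (fun l : L ↦ f (l : L ⧸ G)) = F := funext hf.apply_coe
  refine ⟨by rwa [h1], fun l ↦ ?_⟩
  rw [h1]
  intro y
  obtain ⟨r, hr⟩ : ∃ r : ℝ, r = y := ⟨y, rfl⟩
  have h2 := hf.mvfderiv_intercept_mulInvariantVectorField (hF.mdifferentiable (by simp)) l w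
  have h3 : c l * mvfderiv (𝓡 n) F (1 : L) w ≠ 0 := mul_ne_zero (hf.slope_pos l).ne' hw
  refine ⟨(r / (c l * mvfderiv (𝓡 n) F (1 : L) w)) • mulInvariantVectorField w l, ?_⟩
  rw [← hr]
  change mvfderiv (𝓡 n) F l _ = r
  rw [map_smul, h2, smul_eq_mul, div_mul_cancel₀ _ h3]

end IsAffineCoordinate

end LieSubgroup

end LieLine

theorem mainTheorem6 {n : ℕ} {L : Type*} [TopologicalSpace L]
    [ChartedSpace (EuclideanSpace ℝ (Fin n)) L] [Group L] [LieGroup (𝓡 n) ∞ L]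
    (G : Subgroup L) (hG_closed : IsClosed (G : Set L)) (hG_conn : IsConnected (G : Set L))
    (hX : Nonempty (L ⧸ G ≃ₜ ℝ))
    (N : Subgroup L) (hN_normal : N.Normal) (hN_nilp : Group.IsNilpotent N)
    (hN_lie : LieLine.IsConnectedLieSubgroup n N) (hNG : ¬ N ≤ G) :
    ∃ (f : L ⧸ G ≃ₜ ℝ) (ρ : L →* AffPlus) (Tr : Subgroup L),
      -- the action of `L` on `X = L / G ≅ ℝ` is through a Lie group homomorphism to `Aff⁺(ℝ)`
      (LieLine.IsQuotientDiffeo n f ∧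
        ContMDiff (𝓡 n) 𝓘(ℝ, ℝ) ∞ (fun l : L ↦ AffPlus.slope (ρ l)) ∧
        ContMDiff (𝓡 n) 𝓘(ℝ, ℝ) ∞ (fun l : L ↦ AffPlus.intercept (ρ l)) ∧
        ∀ (l : L) (x : L ⧸ G), f (l • x) = (ρ l : ℝ ≃ᵃ[ℝ] ℝ) (f x)) ∧
      -- the preimage of the translations, and its Lie algebra
      (Tr = AffPlus.translations.comap ρ ∧
        Tr.Normal ∧
        (∀ l : L, l ∈ G.normalCore ↔ ∀ x : L ⧸ G, l • x = x) ∧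
        G.normalCore = ⨅ l : L, G.map (MulAut.conj l).toMonoidHom ∧
        (Tr : Set L) = (G.normalCore : Set L) * (N : Set L) ∧
        LieLine.lieAlg n G.normalCore =
          {u | u ∈ LieLine.lieAlg n G ∧
            ∀ v : GroupLieAlgebra (𝓡 n) L, ⁅u, v⁆ ∈ LieLine.lieAlg n G} ∧
        LieLine.lieAlg n Tr = LieLine.lieAlg n G.normalCore + LieLine.lieAlg n N) ∧
      -- one-parameter groups
      (∀ γ : ℝ → L, LieLine.IsOneParameterGroup γ →
        ((LieLine.ActsTransitively G γ ∨ LieLine.ActsTrivially G γ) ↔ ∀ t, γ t ∈ Tr)) ∧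
      (∀ γ : ℝ → L, LieLine.IsOneParameterGroup γ →
        LieLine.IsAdParabolic n γ ∨ LieLine.IsAdElliptic n γ →
        (LieLine.ActsTransitively G γ ∨ LieLine.ActsTrivially G γ) ∧ ∀ t, γ t ∈ Tr) := by
  have : IsTopologicalGroup L := topologicalGroup_of_lieGroup (𝓡 n) ∞
  obtain ⟨h⟩ := hX
  obtain ⟨𝒮, h𝒮, h𝒮N, hN𝒮⟩ := hN_lie.exists_oneParameterGroups
  obtain ⟨f, c, F, hf, hcc, hcN, γ₀, hγ₀, hFγ₀⟩ := LieLine.exists_isAffineCoordinate h hG_conn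
    hN_normal hN_nilp hNG (fun γ hγ ↦ (h𝒮 γ hγ).choose_spec.isOneParameterGroup) h𝒮N hN𝒮
  obtain ⟨hc, hF⟩ := LieGroup.contMDiff_of_continuous_cocycle (E := EuclideanSpace ℝ (Fin n)) hcc
    hf.continuous_intercept hf.slope_pos hf.slope_mul hf.intercept_mul
  have hcd : MDifferentiableAt (𝓡 n) 𝓘(ℝ, ℝ) c 1 := hc.mdifferentiable (by simp) 1
  have hFd : MDifferentiableAt (𝓡 n) 𝓘(ℝ, ℝ) F 1 := hF.mdifferentiable (by simp) 1
  -- the velocity of a one-parameter group of `N` that acts by the translations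
  obtain ⟨w, hw⟩ := h𝒮 γ₀ hγ₀
  have hFw : mvfderiv (𝓡 n) F (1 : L) w = 1 := by
    have h1 := hw.hasDerivAt_comp hFd
    rw [show F ∘ γ₀ = id from funext hFγ₀] at h1
    exact h1.unique (hasDerivAt_id 0)
  have hcw : mvfderiv (𝓡 n) c (1 : L) w = 0 :=
    (hf.mvfderiv_slope_eq_zero_iff hcd hw).2 fun t ↦ hcN _ (h𝒮N γ₀ hγ₀ t)
  refine ⟨f, hf.toAffPlus, AffPlus.translations.comap hf.toAffPlus,
    ⟨hf.isQuotientDiffeo hF (hFw ▸ one_ne_zero), ?_, ?_, hf.apply_smul⟩,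
    ⟨rfl, ⟨fun l hl m ↦ ?_⟩, QuotientGroup.mem_normalCore_iff_forall_smul_eq G,
      G.normalCore_eq_iInf_map_conj, ?_, ?_, ?_⟩, fun γ hγ ↦ ?_, fun γ hγ hAd ↦ ?_⟩
  · exact hc.congr fun l ↦ AffPlus.slope_ofSlopeIntercept _ _ (hf.slope_pos l)
  · exact hF.congr fun l ↦ AffPlus.intercept_ofSlopeIntercept _ _ (hf.slope_pos l)
  · rw [hf.mem_comap_translations] at hl ⊢
    rw [hf.slope_mul, hf.slope_mul, hl, mul_one, ← hf.slope_mul, mul_inv_cancel, hf.slope_one]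
  · ext l
    rw [SetLike.mem_coe, hf.mem_comap_translations, Set.mem_mul]
    constructor
    · intro hl
      have hn := h𝒮N γ₀ hγ₀ (F l)
      have hn' := h𝒮N γ₀ hγ₀ (-F l)
      refine ⟨l * γ₀ (-F l), (hf.mem_normalCore_iff _).2 ⟨?_, ?_⟩, γ₀ (F l), hn, ?_⟩
      · rw [hf.slope_mul, hl, hcN _ hn', mul_one]
      · rw [hf.intercept_mul, hl, hFγ₀, one_mul, neg_add_cancel]
      · rw [mul_assoc, ← hw.isOneParameterGroup.map_add, neg_add_cancel,
          hw.isOneParameterGroup.map_zero, mul_one]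
    · rintro ⟨g, hg, m, hm, rfl⟩
      rw [hf.slope_mul, ((hf.mem_normalCore_iff g).1 hg).1, hcN m hm, one_mul]
  · ext u
    rw [hf.mem_lieAlg_normalCore_iff hcd hFd]
    simp only [Set.mem_ofPred_eq, hf.mem_lieAlg_iff hFd, hf.mvfderiv_intercept_bracket hc hF]
    constructor
    · rintro ⟨hu, hu'⟩
      exact ⟨hu', fun v ↦ by rw [hu, hu', zero_mul, mul_zero, sub_zero]⟩
    · rintro ⟨hu', hu⟩
      have h1 := hu w
      rw [hFw, hu', mul_zero, sub_zero, mul_one] at h1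
      exact ⟨h1, hu'⟩
  · ext u
    rw [hf.mem_lieAlg_comap_translations_iff hcd, Set.mem_add]
    constructor
    · intro hu
      refine ⟨u - mvfderiv (𝓡 n) F (1 : L) u • w, ?_, mvfderiv (𝓡 n) F (1 : L) u • w,
        ⟨_, hw.comp_mul _, fun t ↦ h𝒮N γ₀ hγ₀ _⟩, sub_add_cancel _ _⟩
      rw [hf.mem_lieAlg_normalCore_iff hcd hFd]
      simp [hu, hcw, hFw]
    · rintro ⟨a, ha, b, ⟨γ, hγ, hγN⟩, rfl⟩
      rw [map_add, ((hf.mem_lieAlg_normalCore_iff hcd hFd a).1 ha).1,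
        (hf.mvfderiv_slope_eq_zero_iff hcd hγ).2 fun t ↦ hcN _ (hγN t), add_zero]
  · simp only [hf.mem_comap_translations]
    exact hf.actsTransitively_or_actsTrivially_iff hγ
  · have hslope : ∀ t, c (γ t) = 1 := by
      intro t
      by_contra hne
      obtain ⟨ℓ, hℓw, hℓ⟩ := hf.exists_eigenform hc hF hcw (by rw [hFw]; exact one_ne_zero) hne
      rcases hAd with hAd | hAd
      · exact hne (LieLine.eq_one_of_isNilpotent_sub_one (hAd t) hℓw hℓ)
      · have h1 := (hAd t).2 (c (γ t) : ℂ)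
          ((LieLine.isRoot_charpoly_of_eigenform hℓw hℓ).map (f := algebraMap ℝ ℂ))
        rw [Complex.norm_real, Real.norm_of_nonneg (hf.slope_pos _).le] at h1
        exact hne h1
    refine ⟨(hf.actsTransitively_or_actsTrivially_iff hγ).2 hslope, fun t ↦ ?_⟩
    exact (hf.mem_comap_translations _).2 (hslope t)
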